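/- **Setting.** Let $m,d,c$ and $n_1,\dots,n_m$ be natural numbers, and for $t=1,\dots,m$ let $X_t\in\mathbb R^{n_t\times d}$, $\hat L_t\in\mathbb R^{n_t\times n_t}$ and $\omega_t\ge 0$; let $\alpha\ge 0$, $\beta>0$ and $p>0$ (for instance $p\le 1$). For $W_t\in\mathbb R^{d\times c}$ and $F_t\in\mathbb R^{n_t\times c}$ put $$f_t(W_t,F_t)=\omega_t\big(\operatorname{Tr}(F_t^T\hat L_tF_t)+\alpha\|F_t-X_tW_t\|_F^2\big),\qquad g(\mathcal Z)=\beta\|\mathcal Z\|_{S_p}^p .$$ Here $\mathcal Z=(Z_1,\dots,Z_m)$, $Z_t\in\mathbb R^{d\times c}$, is regarded as a third-order tensor (in any fixed one of its orientations: the third mode may be the client, the column or the row index of the $Z_t$), and $\|\mathcal Z\|_{S_p}^p$ is the sum of the $p$-th powers of all singular values of all frontal slices of the discrete Fourier transform of the tensor along its third mode. The problem is $$\min_{W,F}\ \sum_{t=1}^m f_t(W_t,F_t)+g(\mathcal W)\quad\text{subject to } F_t^TF_t=I\ \ (t=1,\dots,m).$$ Split it by the constraint $\mathcal W=\mathcal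 Z$, with the augmented Lagrangian $$\mathcal L_\rho(W,F,\mathcal Z,\mathcal Y)=\sum_t f_t(W_t,F_t)+g(\mathcal Z)+\sum_t\Big(\langle Y_t,W_t-Z_t\rangle+\tfrac\rho2\|W_t-Z_t\|_F^2\Big).$$ **Algorithm.** Fix an integer $J\ge1$ and step sizes $\eta_t>0$. From an arbitrary starting point $(W^0,F^0,\mathcal Z^0,\mathcal Y^0)$, round $k$ consists of the following updates. 1. $W^{k+1}\in\arg\min_W\mathcal L_\rho(W,F^k,\mathcal Z^k,\mathcal Y^k)$. 2. For each $t$, $J$ projected gradient steps: $F_t^{k,0}=F_t^k$; $F_t^{k,j+1}$ is a Frobenius-nearest point to $F_t^{k,j}-\eta_t\nabla_{F_t}f_t(W_t^{k+1},F_t^{k,j})$ among the matrices $Q$ with $Q^TQ=I$, for $0\le j<J$; and $F_t^{k+1}=F_t^{k,J}$. 3. $\mathcal Z^{k+1}\in\arg\min_{\mathcal Z}\mathcal L_\rho(W^{k+1},F^{k+1},\mathcal Z,\mathcal Y^k)$. 4. $Y_t^{k+1}=Y_t^k+\rho(W_t^{k+1}-Z_t^{k+1})$ for each $t$. **Sufficient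 decrease.** With a constant $c_F>0$, assume for all $k$, $t$ and $0\le j<J$ that $$\mathcal L_\rho(\dots,F_t^{k,j+1},\dots)\le\mathcal L_\rho(\dots,F_t^{k,j},\dots)-\tfrac{c_F}{2}\|F_t^{k,j+1}-F_t^{k,j}\|_F^2,$$ where the other arguments are $W^{k+1}$, $F_s^k$ $(s\ne t)$, $\mathcal Z^k$ and $\mathcal Y^k$. (For $J=1$ this reads $\mathcal L_\rho(\dots,F_t^{k+1},\dots)\le\mathcal L_\rho(\dots,F_t^{k},\dots)-\frac{c_F}{2}\|F_t^{k+1}-F_t^k\|_F^2$.) **KKT points.** A point $(W,F,\mathcal Z,\mathcal Y)$ is a KKT point if $W=\mathcal Z$; $F_t^TF_t=I$ and $\nabla_{W_t}f_t(W_t,F_t)+Y_t=0$ for every $t$; for every $t$ there is a symmetric matrix $\Lambda_t$ with $\nabla_{F_t}f_t(W_t,F_t)+F_t\Lambda_t=0$; and $\mathcal Y\in\partial g(\mathcal Z)$, where $\partial g$ is the limiting (Mordukhovich) subdifferential. **Theorem.** For every problem as above, every $J\ge1$ and every $c_F>0$ there is $\rho_1>0$ such that for every $\rho\ge\rho_1$,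 every choice of step sizes $\eta_t>0$ and every sequence $(W^k,F^k,\mathcal Z^k,\mathcal Y^k)_{k\ge0}$ generated by the algorithm with penalty $\rho$ that satisfies the sufficient decrease condition with constant $c_F$, the sequence has at least one limit point (limit of a subsequence), and each of its limit points is a KKT point. -/

import Mathlib

open Filter Topology
open scoped Matrix

noncomputable section

/-- A family of `m` matrices of size `d × c`, one per client: the type of the models `W`, of their
consensus copy `Z` and of the multiplier `Y`. -/
abbrev ModelStack (m d c : ℕ) : Type := Fin m → Matrix (Fin d) (Fin c) ℝ

/-- A family of embeddings `F t`, the one of client `t` being of size `n t × c`. -/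
abbrev EmbeddingStack {m : ℕ} (n : Fin m → ℕ) (c : ℕ) : Type :=
  (t : Fin m) → Matrix (Fin (n t)) (Fin c) ℝ

/-- The Frobenius inner product of two real matrices. -/
def frobInner {a b : ℕ} (A B : Matrix (Fin a) (Fin b) ℝ) : ℝ := (Aᵀ * B).trace

/-- The square of the Frobenius norm. -/
def frobSq {a b : ℕ} (A : Matrix (Fin a) (Fin b) ℝ) : ℝ := frobInner A A

/-- The Frobenius inner product of two stacks of matrices. -/
def stackInner {m d c : ℕ} (V Z : ModelStack m d c) : ℝ := ∑ t, frobInner (V t) (Z t)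

/-- The Frobenius norm of a stack of matrices. -/
def stackNorm {m d c : ℕ} (Z : ModelStack m d c) : ℝ := √(stackInner Z Z)

/-! ### The tensor Schatten quasi-norm -/

/-- The `k`-th frontal slice of the discrete Fourier transform of a third-order tensor along its
third mode. -/
def fourierSlice {n₁ n₂ n₃ : ℕ} (A : Fin n₁ → Fin n₂ → Fin n₃ → ℝ) (k : Fin n₃) :
    Matrix (Fin n₁) (Fin n₂) ℂ :=
  Matrix.of fun i j => ∑ l : Fin n₃,
    Complex.exp (-(2 * Real.pi * Complex.I * (k : ℕ) * (l : ℕ) / (n₃ : ℂ))) * (A i j l : ℂ)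

/-- `‖A‖_{S_p}^p`: the sum of the `p`-th powers of the singular values of all the frontal slices of
the Fourier transform of `A` along the third mode. (A matrix with `n₂` columns has at most `n₂`
nonzero singular values.) -/
def tensorSchattenPow {n₁ n₂ n₃ : ℕ} (p : ℝ) (A : Fin n₁ → Fin n₂ → Fin n₃ → ℝ) : ℝ :=
  ∑ k : Fin n₃, ∑ i ∈ Finset.range n₂,
    (Matrix.toEuclideanLin (fourierSlice A k)).singularValues i ^ p

/-- The orientation in which the matrices of the clients are stacked into a third-order tensor: the
mode of the tensor that comes third, along which the Fourier transform is taken. The order of the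
other two modes is immaterial, a matrix and its transpose having the same nonzero singular
values. -/
inductive StackMode : Type
  | client : StackMode
  | cluster : StackMode
  | feature : StackMode

/-- `‖Z‖_{S_p}^p` for the tensor obtained by stacking the matrices `Z t`. -/
def stackSchattenPow {m d c : ℕ} (mode : StackMode) (p : ℝ) (Z : ModelStack m d c) : ℝ :=
  match mode with
  | .client => tensorSchattenPow p (fun (i : Fin d) (j : Fin c) (t : Fin m) => Z t i j)
  | .cluster => tensorSchattenPow p (fun (i : Fin d) (t : Fin m) (j : Fin c) => Z t i j)
  | .feature => tensorSchattenPow p (fun (j : Fin c) (t : Fin m) (i : Fin d) => Z t i j)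

/-! ### Limiting subdifferential -/

/-- `V` is a regular (Fréchet) subgradient of `g` at `Z`. -/
def IsRegularSubgradient {m d c : ℕ} (g : ModelStack m d c → ℝ) (Z V : ModelStack m d c) : Prop :=
  ∀ ε > 0, ∀ᶠ Z' in 𝓝 Z, g Z + stackInner V (Z' - Z) - ε * stackNorm (Z' - Z) ≤ g Z'

/-- `V` is a limiting (Mordukhovich) subgradient of `g` at `Z`, that is, `V ∈ ∂g(Z)`. -/
def IsLimitingSubgradient {m d c : ℕ} (g : ModelStack m d c → ℝ) (Z V : ModelStack m d c) : Prop :=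
  ∃ (z v : ℕ → ModelStack m d c), (∀ i, IsRegularSubgradient g (z i) (v i)) ∧
    Tendsto z atTop (𝓝 Z) ∧ Tendsto (fun i => g (z i)) atTop (𝓝 (g Z)) ∧ Tendsto v atTop (𝓝 V)

/-! ### The problem -/

/-- The data of the federated problem
`min ∑ t, ω t * (tr (F tᵀ * L t * F t) + α * ‖F t - X t * W t‖²) + β * ‖W‖_{S_p}^p`
subject to `F tᵀ * F t = 1`. -/
structure FedProblem (m d c : ℕ) (n : Fin m → ℕ) where
  X : (t : Fin m) → Matrix (Fin (n t)) (Fin d) ℝ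
  L : (t : Fin m) → Matrix (Fin (n t)) (Fin (n t)) ℝ
  ω : Fin m → ℝ
  α : ℝ
  β : ℝ
  p : ℝ
  mode : StackMode
  ω_nonneg : ∀ t, 0 ≤ ω t
  α_nonneg : 0 ≤ α
  β_pos : 0 < β
  p_pos : 0 < p

namespace FedProblem

variable {m d c : ℕ} {n : Fin m → ℕ} (D : FedProblem m d c n)

/-- The local objective `f_t (W_t, F_t)`. -/
def localObj (t : Fin m) (W : Matrix (Fin d) (Fin c) ℝ) (F : Matrix (Fin (n t)) (Fin c) ℝ) : ℝ :=
  D.ω t * ((Fᵀ * D.L t * F).trace + D.α * frobSq (F - D.X t * W))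

/-- The gradient of `f_t` in `W_t`. -/
def gradW (t : Fin m) (W : Matrix (Fin d) (Fin c) ℝ) (F : Matrix (Fin (n t)) (Fin c) ℝ) :
    Matrix (Fin d) (Fin c) ℝ :=
  (2 * D.ω t * D.α) • ((D.X t)ᵀ * (D.X t * W - F))

/-- The gradient of `f_t` in `F_t` (for a symmetric `L t`, the first summand is `2 * L t * F`). -/
def gradF (t : Fin m) (W : Matrix (Fin d) (Fin c) ℝ) (F : Matrix (Fin (n t)) (Fin c) ℝ) :
    Matrix (Fin (n t)) (Fin c) ℝ :=
  D.ω t • ((D.L t + (D.L t)ᵀ) * F + (2 * D.α) • (F - D.X t * W))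

/-- The regularizer `g (Z) = β * ‖Z‖_{S_p}^p`. -/
def reg (Z : ModelStack m d c) : ℝ := D.β * stackSchattenPow D.mode D.p Z

/-- The augmented Lagrangian for the splitting `W = Z`, with multiplier `Y` and penalty `ρ`. -/
def augLagrangian (ρ : ℝ) (W : ModelStack m d c) (F : EmbeddingStack n c)
    (Z Y : ModelStack m d c) : ℝ :=
  (∑ t, D.localObj t (W t) (F t)) + D.reg Z +
    ∑ t, (frobInner (Y t) (W t - Z t) + ρ / 2 * frobSq (W t - Z t))

end FedProblem

/-! ### The algorithm -/

/-- `P` is a Euclidean projection of `A` onto the matrices with orthonormal columns. -/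
def IsStiefelProj {a b : ℕ} (A P : Matrix (Fin a) (Fin b) ℝ) : Prop :=
  Pᵀ * P = 1 ∧ ∀ Q : Matrix (Fin a) (Fin b) ℝ, Qᵀ * Q = 1 → frobSq (P - A) ≤ frobSq (Q - A)

namespace FedProblem

variable {m d c : ℕ} {n : Fin m → ℕ} (D : FedProblem m d c n)

/-- The sequences `W, F, Z, Y` are generated by the algorithm with penalty `ρ`: exact minimization
in `W`, then `J` projected gradient steps of step size `η t` in each `F t`, then exact minimization
in `Z` (the proximal step of the regularizer), then the update of the multiplier. The `j`-th inner
iterate of client `t` in the round that leads from `F k` to `F (k + 1)` is `G k t j`. -/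
structure IsRun (ρ : ℝ) (J : ℕ) (η : Fin m → ℝ) (W : ℕ → ModelStack m d c)
    (F : ℕ → EmbeddingStack n c) (G : ℕ → (t : Fin m) → ℕ → Matrix (Fin (n t)) (Fin c) ℝ)
    (Z Y : ℕ → ModelStack m d c) : Prop where
  W_step : ∀ k (W' : ModelStack m d c),
    D.augLagrangian ρ (W (k + 1)) (F k) (Z k) (Y k) ≤ D.augLagrangian ρ W' (F k) (Z k) (Y k)
  F_start : ∀ k t, G k t 0 = F k t
  F_step : ∀ k t j, j < J →
    IsStiefelProj (G k t j - η t • D.gradF t (W (k + 1) t) (G k t j)) (G k t (j + 1))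
  F_end : ∀ k t, F (k + 1) t = G k t J
  Z_step : ∀ k (Z' : ModelStack m d c),
    D.augLagrangian ρ (W (k + 1)) (F (k + 1)) (Z (k + 1)) (Y k) ≤
      D.augLagrangian ρ (W (k + 1)) (F (k + 1)) Z' (Y k)
  Y_step : ∀ k t, Y (k + 1) t = Y k t + ρ • (W (k + 1) t - Z (k + 1) t)

/-- Sufficient decrease in the `F t`-subproblems: each projected gradient step decreases the
augmented Lagrangian by at least `cF / 2` times the square of its length. With one projected
gradient step per round (`J = 1`), the two inner iterates are `F k t` and `F (k + 1) t`. -/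
def SufficientDecrease (cF ρ : ℝ) (J : ℕ) (W : ℕ → ModelStack m d c)
    (F : ℕ → EmbeddingStack n c) (G : ℕ → (t : Fin m) → ℕ → Matrix (Fin (n t)) (Fin c) ℝ)
    (Z Y : ℕ → ModelStack m d c) : Prop :=
  ∀ k t j, j < J →
    D.augLagrangian ρ (W (k + 1)) (Function.update (F k) t (G k t (j + 1))) (Z k) (Y k) ≤
      D.augLagrangian ρ (W (k + 1)) (Function.update (F k) t (G k t j)) (Z k) (Y k)
        - cF / 2 * frobSq (G k t (j + 1) - G k t j)

/-- `(W, F, Z, Y)` is a KKT point of the problem, written with the constraint `W = Z` and its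
multiplier `Y`; the multipliers of the constraints `F tᵀ * F t = 1` are the symmetric
matrices `Λ`. -/
structure IsKKT (W : ModelStack m d c) (F : EmbeddingStack n c) (Z Y : ModelStack m d c) :
    Prop where
  consensus : W = Z
  orthonormal : ∀ t, (F t)ᵀ * F t = 1
  stationary_W : ∀ t, D.gradW t (W t) (F t) + Y t = 0
  stationary_F : ∀ t, ∃ Λ : Matrix (Fin c) (Fin c) ℝ, Λᵀ = Λ ∧
    D.gradF t (W t) (F t) + F t * Λ = 0
  stationary_Z : IsLimitingSubgradient D.reg Z Y

end FedProblem

/-- `x` is a limit point of the sequence `u`: the limit of one of its subsequences. -/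
def IsSeqLimitPoint {E : Type*} [TopologicalSpace E] (u : ℕ → E) (x : E) : Prop :=
  ∃ φ : ℕ → ℕ, StrictMono φ ∧ Tendsto (u ∘ φ) atTop (𝓝 x)

end

/-! ### Spectral functions of the singular values -/

/-! The argument does not use the augmented Lagrangian as a Lyapunov function: the last block `Z`
carries the nonsmooth term, so its optimality condition gives no Lipschitz control of the
multiplier. Instead the multiplier is eliminated. Stationarity of the `W`-step and the dual update
give `Y (k+1) = ρ (Z k - Z (k+1)) - ∇_W f (W (k+1), F k)` (`IsRun.Y_succ`), so the `Z`-step is a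
proximal gradient step for the original objective at `Z k`, with the gradient evaluated at the
nearby point `W (k+1)`.

The objective at the consensus copy, `energy (Z k) (F k)`, therefore drops by `ρ/2 ‖ΔZ‖²` plus a
multiple of the squared inner steps, up to an error `C (‖ΔZ‖² + ‖W (k+1) - Z k‖²)` with `C`
independent of `ρ` (`exists_energy_descent`). The gap `‖W (k+1) - Z k‖²` contracts by a factor 1/2,
up to the other step lengths (`exists_modelGap_recursion`). For large `ρ` a weighted sum of the
energy and these quantities decreases strictly, and orthonormality of `F` bounds it below; hence all
steps tend to zero and the regularizer stays bounded (`exists_asymptotic_regularity`).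

Compactness then requires the regularizer to be coercive, and passage to the limit in the
subdifferential requires it to be continuous. Both are proved for all `p > 0`, through traces of
powers of `Aᴴ * A` and Fourier inversion. A limit of projected gradient steps of vanishing length is
a fixed point of the projected gradient map, which supplies the symmetric multiplier `Λ`. -/

theorem LinearMap.IsSymmetric.trace_pow_eq_sum_eigenvalues {E : Type*} [NormedAddCommGroup E]
    [InnerProductSpace ℂ E] [FiniteDimensional ℂ E] {N : ℕ} {T : E →ₗ[ℂ] E} (hT : T.IsSymmetric)
    (hN : Module.finrank ℂ E = N) (k : ℕ) :
    LinearMap.trace ℂ E (T ^ k) = ∑ i, ((hT.eigenvalues hN i ^ k : ℝ) : ℂ) := by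
  rw [LinearMap.trace_eq_sum_inner _ (hT.eigenvectorBasis hN)]
  refine Finset.sum_congr rfl fun i _ => ?_
  have h : (T ^ k) (hT.eigenvectorBasis hN i) =
      ((hT.eigenvalues hN i : ℂ) ^ k) • hT.eigenvectorBasis hN i := by
    induction k with
    | zero => simp
    | succ k ih =>
      rw [pow_succ', Module.End.mul_apply, ih, map_smul, hT.apply_eigenvectorBasis, smul_smul,
        pow_succ]
      rfl
  rw [h, inner_smul_right]
  simp [inner_self_eq_norm_sq_to_K]

/-- The squared singular values are the eigenvalues of `Aᴴ * A`. Their power sums are thus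
polynomial in the real and imaginary parts of the entries, which gives continuity without tracking
individual singular values. -/
theorem Matrix.sum_singularValues_sq_pow {n₁ n₂ : ℕ} (A : Matrix (Fin n₁) (Fin n₂) ℂ) (k : ℕ) :
    ∑ i ∈ Finset.range n₂, ((Matrix.toEuclideanLin A).singularValues i ^ 2) ^ k =
      (((Aᴴ * A) ^ k).trace).re := by
  set T := Matrix.toEuclideanLin A
  have hN : Module.finrank ℂ (EuclideanSpace ℂ (Fin n₂)) = n₂ := by simp
  have hcomp : T.adjoint ∘ₗ T = Matrix.toEuclideanLin (Aᴴ * A) := by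
    rw [← Matrix.toEuclideanLin_conjTranspose_eq_adjoint]
    ext x i
    simp [T, Matrix.toLpLin_apply]
  have htr : LinearMap.trace ℂ _ ((T.adjoint ∘ₗ T) ^ k) = ((Aᴴ * A) ^ k).trace := by
    rw [hcomp, Matrix.toEuclideanLin_eq_toLin_orthonormal]
    rw [← Matrix.toLin_pow, Matrix.trace_toLin_eq]
  rw [← htr, T.isSymmetric_adjoint_comp_self.trace_pow_eq_sum_eigenvalues hN,
    ← Complex.ofReal_sum, Complex.ofReal_re, Finset.sum_range]
  simp_rw [T.sq_singularValues_fin hN]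

theorem Matrix.sum_eval_singularValues_sq {n₁ n₂ : ℕ} (A : Matrix (Fin n₁) (Fin n₂) ℂ)
    (q : Polynomial ℝ) :
    ∑ i ∈ Finset.range n₂, q.eval ((Matrix.toEuclideanLin A).singularValues i ^ 2) =
      ∑ k ∈ Finset.range (q.natDegree + 1), q.coeff k * (((Aᴴ * A) ^ k).trace).re := by
  simp_rw [Polynomial.eval_eq_sum_range]
  rw [Finset.sum_comm]
  simp_rw [← Finset.mul_sum, Matrix.sum_singularValues_sq_pow]

theorem Matrix.sum_singularValues_sq {n₁ n₂ : ℕ} (A : Matrix (Fin n₁) (Fin n₂) ℂ) :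
    ∑ i ∈ Finset.range n₂, (Matrix.toEuclideanLin A).singularValues i ^ 2 =
      ∑ i, ∑ j, ‖A i j‖ ^ 2 := by
  have h := Matrix.sum_singularValues_sq_pow A 1
  simp only [pow_one] at h
  rw [h, Matrix.trace, Complex.re_sum, Finset.sum_comm]
  refine Finset.sum_congr rfl fun j _ => ?_
  rw [Matrix.diag_apply, Matrix.mul_apply, Complex.re_sum]
  refine Finset.sum_congr rfl fun i _ => ?_
  rw [Matrix.conjTranspose_apply, Complex.sq_norm, Complex.normSq_apply]
  simp

/-- The sum of the values of a continuous function at the squares of the singular values depends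
continuously on the matrix. -/
theorem Matrix.continuous_sum_singularValues_sq {n₁ n₂ : ℕ} {h : ℝ → ℝ} (hh : Continuous h) :
    Continuous fun A : Matrix (Fin n₁) (Fin n₂) ℂ =>
      ∑ i ∈ Finset.range n₂, h ((Matrix.toEuclideanLin A).singularValues i ^ 2) := by
  rw [continuous_iff_continuousAt]
  intro A₀
  refine continuousAt_of_locally_uniform_approx_of_continuousAt fun u hu => ?_
  obtain ⟨ε, hε, hεu⟩ := Metric.mem_uniformity_dist.1 hu
  let N : Matrix (Fin n₁) (Fin n₂) ℂ → ℝ := fun A => ∑ i, ∑ j, ‖A i j‖ ^ 2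
  have hN : Continuous N := by fun_prop
  -- Weierstrass approximation on an interval containing all squared singular values of matrices
  -- near `A₀`, since each is at most the squared Frobenius norm `N A`. The tolerance `ε / (n₂ + 1)`
  -- keeps the sum of `n₂` errors strictly below `ε`, also for `n₂ = 0`.
  obtain ⟨q, hq⟩ := exists_polynomial_near_of_continuousOn 0 (N A₀ + 1) h hh.continuousOn
    (ε / (n₂ + 1)) (by positivity)
  refine ⟨{A | N A < N A₀ + 1}, (isOpen_lt hN continuous_const).mem_nhds (by simp),
    fun A => ∑ i ∈ Finset.range n₂, q.eval ((Matrix.toEuclideanLin A).singularValues i ^ 2), ?_, ?_⟩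
  · simp_rw [Matrix.sum_eval_singularValues_sq]
    refine Continuous.continuousAt ?_
    fun_prop
  · intro A hA
    apply hεu
    rw [Real.dist_eq, ← Finset.sum_sub_distrib]
    refine (Finset.abs_sum_le_sum_abs _ _).trans_lt ?_
    have hb : ∀ i ∈ Finset.range n₂,
        |h ((Matrix.toEuclideanLin A).singularValues i ^ 2) -
          q.eval ((Matrix.toEuclideanLin A).singularValues i ^ 2)| ≤ ε / (n₂ + 1) := by
      intro i hi
      rw [abs_sub_comm]
      refine (hq _ ⟨sq_nonneg _, ?_⟩).le
      refine le_trans ?_ (le_of_lt hA)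
      change _ ≤ ∑ i, ∑ j, ‖A i j‖ ^ 2
      rw [← Matrix.sum_singularValues_sq]
      exact Finset.single_le_sum
        (f := fun i => (Matrix.toEuclideanLin A).singularValues i ^ 2)
        (fun i _ => sq_nonneg _) hi
    refine (Finset.sum_le_sum hb).trans_lt ?_
    rw [Finset.sum_const, Finset.card_range, nsmul_eq_mul, ← mul_div_assoc,
      div_lt_iff₀ (by positivity)]
    nlinarith

theorem Matrix.continuous_sum_singularValues_rpow {n₁ n₂ : ℕ} {p : ℝ} (hp : 0 < p) :
    Continuous fun A : Matrix (Fin n₁) (Fin n₂) ℂ =>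
      ∑ i ∈ Finset.range n₂, (Matrix.toEuclideanLin A).singularValues i ^ p := by
  have h := Matrix.continuous_sum_singularValues_sq (n₁ := n₁) (n₂ := n₂)
    (h := fun x => x ^ (p / 2)) (Real.continuous_rpow_const (by positivity))
  refine h.congr fun A => Finset.sum_congr rfl fun i _ => ?_
  rw [← Real.rpow_natCast_mul (LinearMap.singularValues_nonneg _ _)]
  congr 1
  push_cast
  ring

/-- A bound on the Schatten quasi-norm bounds the entries of a matrix. -/
theorem Matrix.sum_norm_sq_le_of_sum_singularValues_rpow_le {n₁ n₂ : ℕ} {p M : ℝ} (hp : 0 < p)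
    (A : Matrix (Fin n₁) (Fin n₂) ℂ)
    (hA : ∑ i ∈ Finset.range n₂, (Matrix.toEuclideanLin A).singularValues i ^ p ≤ M) :
    ∑ i, ∑ j, ‖A i j‖ ^ 2 ≤ n₂ * (M ^ p⁻¹) ^ 2 := by
  rw [← Matrix.sum_singularValues_sq, ← nsmul_eq_mul]
  conv_rhs => rw [← Finset.card_range n₂]
  refine Finset.sum_le_card_nsmul _ _ _ fun i hi => ?_
  have h0 := LinearMap.singularValues_nonneg (Matrix.toEuclideanLin A) i
  refine pow_le_pow_left₀ h0 ?_ 2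
  have h1 : (Matrix.toEuclideanLin A).singularValues i ^ p ≤ M :=
    (Finset.single_le_sum (f := fun i => (Matrix.toEuclideanLin A).singularValues i ^ p)
      (fun i _ => Real.rpow_nonneg (LinearMap.singularValues_nonneg _ _) _) hi).trans hA
  rw [← Real.rpow_rpow_inv h0 hp.ne']
  exact Real.rpow_le_rpow (by positivity) h1 (by positivity)

/-! ### The discrete Fourier transform -/

/-- Fourier inversion: for `l' ≠ l` the inner sum is a full geometric sum of an `n₃`-th root of
unity `ζ ≠ 1`, hence zero. It transfers bounds on the slices back to the tensor. -/
theorem sum_exp_mul_fourierSlice {n₁ n₂ n₃ : ℕ} (A : Fin n₁ → Fin n₂ → Fin n₃ → ℝ) (i : Fin n₁)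
    (j : Fin n₂) (l : Fin n₃) :
    ∑ k : Fin n₃, Complex.exp (2 * Real.pi * Complex.I * (k : ℕ) * (l : ℕ) / (n₃ : ℂ)) *
      fourierSlice A k i j = n₃ * (A i j l : ℂ) := by
  have hn : n₃ ≠ 0 := fun h => by subst h; exact l.elim0
  have hn' : (n₃ : ℂ) ≠ 0 := by exact_mod_cast hn
  simp only [fourierSlice, Matrix.of_apply, Finset.mul_sum]
  rw [Finset.sum_comm, Finset.sum_eq_single l]
  · rw [Finset.sum_congr rfl (g := fun _ => (A i j l : ℂ))]
    · simp
    · intro k _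
      rw [← mul_assoc, ← Complex.exp_add, add_neg_cancel, Complex.exp_zero, one_mul]
  · intro l' _ hl'
    set ζ : ℂ := Complex.exp (2 * Real.pi * Complex.I * ((l : ℕ) - (l' : ℕ)) / n₃) with hζ
    have hterm : ∀ k : Fin n₃,
        Complex.exp (2 * Real.pi * Complex.I * (k : ℕ) * (l : ℕ) / (n₃ : ℂ)) *
          (Complex.exp (-(2 * Real.pi * Complex.I * (k : ℕ) * (l' : ℕ) / (n₃ : ℂ))) *
            (A i j l' : ℂ)) = ζ ^ (k : ℕ) * (A i j l' : ℂ) := by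
      intro k
      rw [← mul_assoc, ← Complex.exp_add, hζ, ← Complex.exp_nat_mul]
      congr 2
      ring
    simp_rw [hterm]
    rw [← Finset.sum_mul, ← Finset.sum_range (fun k => ζ ^ k)]
    have h1 : ζ ≠ 1 := by
      intro h
      rw [hζ, Complex.exp_eq_one_iff] at h
      obtain ⟨a, ha⟩ := h
      have h2 : (((l : ℕ) : ℂ) - (l' : ℕ)) = a * n₃ := by
        have := Complex.two_pi_I_ne_zero
        field_simp at ha
        linear_combination ha
      have h3 : ((l : ℕ) : ℤ) - (l' : ℕ) = a * n₃ := by exact_mod_cast h2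
      have h4 : ((l : ℕ) : ℤ) - (l' : ℕ) = 0 := by
        refine Int.eq_zero_of_abs_lt_dvd (m := n₃) ⟨a, by rw [h3, mul_comm]⟩ ?_
        have := l.2
        have := l'.2
        rw [abs_lt]
        constructor <;> omega
      exact hl' (Fin.ext (by omega))
    have h2 : ζ ^ n₃ = 1 := by
      rw [hζ, ← Complex.exp_nat_mul, Complex.exp_eq_one_iff]
      refine ⟨(l : ℕ) - (l' : ℕ), ?_⟩
      push_cast
      field_simp
    have h3 := geom_sum_mul ζ n₃
    rw [h2, sub_self] at h3
    rw [(mul_eq_zero.1 h3).resolve_right (sub_ne_zero.2 h1), zero_mul]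
  · simp

theorem abs_le_of_norm_fourierSlice_le {n₁ n₂ n₃ : ℕ} {A : Fin n₁ → Fin n₂ → Fin n₃ → ℝ} {R : ℝ}
    {i : Fin n₁} {j : Fin n₂} (h : ∀ k, ‖fourierSlice A k i j‖ ≤ R) (l : Fin n₃) :
    |A i j l| ≤ R := by
  have hn : (0 : ℝ) < n₃ := by exact_mod_cast (Nat.zero_le _).trans_lt l.2
  refine le_of_mul_le_mul_left ?_ hn
  have h1 := congrArg norm (sum_exp_mul_fourierSlice A i j l)
  rw [norm_mul, Complex.norm_natCast, Complex.norm_real, Real.norm_eq_abs] at h1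
  rw [← h1]
  refine (norm_sum_le _ _).trans ?_
  have h2 : ∀ k : Fin n₃, ‖Complex.exp (2 * Real.pi * Complex.I * (k : ℕ) * (l : ℕ) / (n₃ : ℂ)) *
      fourierSlice A k i j‖ ≤ R := by
    intro k
    have h3 : (2 * Real.pi * Complex.I * (k : ℕ) * (l : ℕ) / (n₃ : ℂ)) =
        ((2 * Real.pi * (k : ℕ) * (l : ℕ) / n₃ : ℝ) : ℂ) * Complex.I := by
      push_cast
      ring
    rw [norm_mul, h3, Complex.norm_exp_ofReal_mul_I, one_mul]
    exact h k
  refine (Finset.sum_le_sum fun k _ => h2 k).trans ?_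
  simp

theorem continuous_tensorSchattenPow {n₁ n₂ n₃ : ℕ} {p : ℝ} (hp : 0 < p) :
    Continuous fun A : Fin n₁ → Fin n₂ → Fin n₃ → ℝ => tensorSchattenPow p A := by
  have h : ∀ k : Fin n₃, Continuous fun A : Fin n₁ → Fin n₂ → Fin n₃ → ℝ => fourierSlice A k := by
    intro k
    refine continuous_matrix fun i j => ?_
    simp only [fourierSlice, Matrix.of_apply]
    fun_prop
  exact continuous_finsetSum _ fun k _ =>
    (Matrix.continuous_sum_singularValues_rpow hp).comp (h k)

theorem tensorSchattenPow_nonneg {n₁ n₂ n₃ : ℕ} (p : ℝ) (A : Fin n₁ → Fin n₂ → Fin n₃ → ℝ) :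
    0 ≤ tensorSchattenPow p A :=
  Finset.sum_nonneg fun _ _ => Finset.sum_nonneg fun _ _ =>
    Real.rpow_nonneg (LinearMap.singularValues_nonneg _ _) _

/-- Coercivity: every singular value of every slice is at most `M ^ p⁻¹`, which bounds the slices
entrywise and, by inversion, the tensor. No triangle inequality is used, so `p < 1` is allowed. -/
theorem exists_abs_le_of_tensorSchattenPow_le {p : ℝ} (hp : 0 < p) (n₁ n₂ n₃ : ℕ) (M : ℝ) :
    ∃ R : ℝ, ∀ A : Fin n₁ → Fin n₂ → Fin n₃ → ℝ, tensorSchattenPow p A ≤ M →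
      ∀ i j l, |A i j l| ≤ R := by
  refine ⟨√(n₂ * (M ^ p⁻¹) ^ 2), fun A hA i j l =>
    abs_le_of_norm_fourierSlice_le (fun k => Real.le_sqrt_of_sq_le ?_) l⟩
  refine le_trans ?_ (Matrix.sum_norm_sq_le_of_sum_singularValues_rpow_le hp (fourierSlice A k)
    (le_trans ?_ hA))
  · exact (Finset.single_le_sum (f := fun j => ‖fourierSlice A k i j‖ ^ 2)
      (fun _ _ => sq_nonneg _) (Finset.mem_univ j)).trans
      (Finset.single_le_sum (f := fun i => ∑ j, ‖fourierSlice A k i j‖ ^ 2)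
        (fun _ _ => Finset.sum_nonneg fun _ _ => sq_nonneg _) (Finset.mem_univ i))
  · exact Finset.single_le_sum (f := fun k => ∑ i ∈ Finset.range n₂,
      (Matrix.toEuclideanLin (fourierSlice A k)).singularValues i ^ p)
      (fun _ _ => Finset.sum_nonneg fun _ _ =>
        Real.rpow_nonneg (LinearMap.singularValues_nonneg _ _) _) (Finset.mem_univ k)

/-! ### Transfer to stacks of matrices, for each orientation. -/

theorem stackSchattenPow_nonneg {m d c : ℕ} (mode : StackMode) (p : ℝ) (Z : ModelStack m d c) :
    0 ≤ stackSchattenPow mode p Z := by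
  cases mode <;> exact tensorSchattenPow_nonneg _ _

theorem continuous_stackSchattenPow {m d c : ℕ} (mode : StackMode) {p : ℝ} (hp : 0 < p) :
    Continuous fun Z : ModelStack m d c => stackSchattenPow mode p Z := by
  cases mode <;>
  · refine (continuous_tensorSchattenPow hp).comp (g := fun A => tensorSchattenPow p A) ?_
    refine continuous_pi fun _ => continuous_pi fun _ => continuous_pi fun _ => ?_
    exact (continuous_apply _).matrix_elem _ _

theorem exists_abs_le_of_stackSchattenPow_le (m d c : ℕ) (mode : StackMode) {p : ℝ} (hp : 0 < p)
    (M : ℝ) :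
    ∃ R : ℝ, ∀ Z : ModelStack m d c, stackSchattenPow mode p Z ≤ M → ∀ t i j, |Z t i j| ≤ R := by
  cases mode
  · obtain ⟨R, hR⟩ := exists_abs_le_of_tensorSchattenPow_le hp d c m M
    exact ⟨R, fun Z hZ t i j => hR _ hZ i j t⟩
  · obtain ⟨R, hR⟩ := exists_abs_le_of_tensorSchattenPow_le hp d m c M
    exact ⟨R, fun Z hZ t i j => hR _ hZ i t j⟩
  · obtain ⟨R, hR⟩ := exists_abs_le_of_tensorSchattenPow_le hp c m d M
    exact ⟨R, fun Z hZ t i j => hR _ hZ j t i⟩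

/-! ### The Frobenius inner product -/

section Frobenius

variable {a b r : ℕ}

theorem frobInner_eq_sum (A B : Matrix (Fin a) (Fin b) ℝ) :
    frobInner A B = ∑ i, ∑ j, A i j * B i j := by
  simp only [frobInner, Matrix.trace, Matrix.diag_apply, Matrix.mul_apply, Matrix.transpose_apply]
  exact Finset.sum_comm

theorem frobSq_eq_sum (A : Matrix (Fin a) (Fin b) ℝ) : frobSq A = ∑ i, ∑ j, A i j ^ 2 := by
  simp only [frobSq, frobInner_eq_sum, sq]

theorem frobInner_comm (A B : Matrix (Fin a) (Fin b) ℝ) : frobInner A B = frobInner B A := by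
  simp only [frobInner_eq_sum, mul_comm]

theorem frobInner_add_left (A B C : Matrix (Fin a) (Fin b) ℝ) :
    frobInner (A + B) C = frobInner A C + frobInner B C := by
  simp [frobInner, Matrix.add_mul]

theorem frobInner_add_right (A B C : Matrix (Fin a) (Fin b) ℝ) :
    frobInner A (B + C) = frobInner A B + frobInner A C := by
  simp [frobInner, Matrix.mul_add]

theorem frobInner_sub_left (A B C : Matrix (Fin a) (Fin b) ℝ) :
    frobInner (A - B) C = frobInner A C - frobInner B C := by
  simp [frobInner, Matrix.sub_mul]

theorem frobInner_sub_right (A B C : Matrix (Fin a) (Fin b) ℝ) :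
    frobInner A (B - C) = frobInner A B - frobInner A C := by
  simp [frobInner, Matrix.mul_sub]

theorem frobInner_neg_left (A B : Matrix (Fin a) (Fin b) ℝ) :
    frobInner (-A) B = -frobInner A B := by
  simp [frobInner]

theorem frobInner_smul_left (s : ℝ) (A B : Matrix (Fin a) (Fin b) ℝ) :
    frobInner (s • A) B = s * frobInner A B := by
  simp [frobInner]

theorem frobInner_smul_right (s : ℝ) (A B : Matrix (Fin a) (Fin b) ℝ) :
    frobInner A (s • B) = s * frobInner A B := by
  simp [frobInner]

theorem frobInner_transpose_mul_left (X : Matrix (Fin r) (Fin a) ℝ) (U : Matrix (Fin r) (Fin b) ℝ)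
    (V : Matrix (Fin a) (Fin b) ℝ) : frobInner (Xᵀ * U) V = frobInner U (X * V) := by
  simp [frobInner, Matrix.mul_assoc]

theorem frobInner_mul_left (X : Matrix (Fin a) (Fin r) ℝ) (U : Matrix (Fin r) (Fin b) ℝ)
    (V : Matrix (Fin a) (Fin b) ℝ) : frobInner V (X * U) = frobInner (V * Uᵀ) X := by
  rw [frobInner, frobInner, Matrix.transpose_mul, Matrix.transpose_transpose, ← Matrix.mul_assoc,
    Matrix.trace_mul_comm, ← Matrix.mul_assoc]

theorem frobSq_nonneg (A : Matrix (Fin a) (Fin b) ℝ) : 0 ≤ frobSq A := by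
  rw [frobSq_eq_sum]
  positivity

theorem sq_le_frobSq (A : Matrix (Fin a) (Fin b) ℝ) (i : Fin a) (j : Fin b) :
    A i j ^ 2 ≤ frobSq A := by
  rw [frobSq_eq_sum]
  exact (Finset.single_le_sum (f := fun j => A i j ^ 2)
      (fun _ _ => sq_nonneg _) (Finset.mem_univ j)).trans
      (Finset.single_le_sum (f := fun i => ∑ j, A i j ^ 2)
        (fun _ _ => Finset.sum_nonneg fun _ _ => sq_nonneg _) (Finset.mem_univ i))

theorem eq_zero_of_frobSq_eq_zero {A : Matrix (Fin a) (Fin b) ℝ} (h : frobSq A = 0) : A = 0 := by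
  ext i j
  have := sq_le_frobSq A i j
  rw [h] at this
  exact pow_eq_zero_iff two_ne_zero |>.1 (le_antisymm this (sq_nonneg _))

theorem frobSq_smul (s : ℝ) (A : Matrix (Fin a) (Fin b) ℝ) : frobSq (s • A) = s ^ 2 * frobSq A := by
  rw [frobSq, frobSq, frobInner_smul_left, frobInner_smul_right]
  ring

theorem frobSq_sub_comm (A B : Matrix (Fin a) (Fin b) ℝ) : frobSq (A - B) = frobSq (B - A) := by
  simp only [frobSq_eq_sum, Matrix.sub_apply, sub_sq_comm]

theorem frobSq_transpose (A : Matrix (Fin a) (Fin b) ℝ) : frobSq Aᵀ = frobSq A := by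
  simp only [frobSq_eq_sum, Matrix.transpose_apply]
  exact Finset.sum_comm

theorem frobSq_mul_le (X : Matrix (Fin r) (Fin a) ℝ) (V : Matrix (Fin a) (Fin b) ℝ) :
    frobSq (X * V) ≤ frobSq X * frobSq V := by
  rw [← frobSq_transpose V]
  simp only [frobSq_eq_sum, Matrix.mul_apply]
  rw [Finset.sum_mul_sum]
  refine Finset.sum_le_sum fun i _ => Finset.sum_le_sum fun j _ => ?_
  exact Finset.sum_mul_sq_le_sq_mul_sq _ _ _

theorem frobSq_sub (A B : Matrix (Fin a) (Fin b) ℝ) :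
    frobSq (A - B) = frobSq A - 2 * frobInner A B + frobSq B := by
  simp only [frobSq, frobInner_sub_left, frobInner_sub_right, frobInner_comm B A]
  ring

theorem frobSq_add (A B : Matrix (Fin a) (Fin b) ℝ) :
    frobSq (A + B) = frobSq A + 2 * frobInner A B + frobSq B := by
  simp only [frobSq, frobInner_add_left, frobInner_add_right, frobInner_comm B A]
  ring

theorem two_mul_frobInner_le (A B : Matrix (Fin a) (Fin b) ℝ) :
    2 * frobInner A B ≤ frobSq A + frobSq B := by
  have := frobSq_nonneg (A - B)
  rw [frobSq_sub] at this
  linarith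

theorem neg_two_mul_frobInner_le (A B : Matrix (Fin a) (Fin b) ℝ) :
    -(2 * frobInner A B) ≤ frobSq A + frobSq B := by
  have := frobSq_nonneg (A + B)
  rw [frobSq_add] at this
  linarith

theorem frobSq_sum_le {ι : Type*} (s : Finset ι) (V : ι → Matrix (Fin a) (Fin b) ℝ) :
    frobSq (∑ i ∈ s, V i) ≤ s.card * ∑ i ∈ s, frobSq (V i) := by
  have h : ∑ i ∈ s, frobSq (V i) = ∑ x, ∑ y, ∑ i ∈ s, V i x y ^ 2 := by
    simp only [frobSq_eq_sum]
    rw [Finset.sum_comm]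
    exact Finset.sum_congr rfl fun x _ => Finset.sum_comm
  rw [h, frobSq_eq_sum, Finset.mul_sum]
  refine Finset.sum_le_sum fun x _ => ?_
  rw [Finset.mul_sum]
  refine Finset.sum_le_sum fun y _ => ?_
  rw [Matrix.sum_apply]
  exact sq_sum_le_card_mul_sum_sq

theorem continuous_frobInner : Continuous fun x : Matrix (Fin a) (Fin b) ℝ × Matrix (Fin a) (Fin b) ℝ
    => frobInner x.1 x.2 := by
  unfold frobInner
  fun_prop

theorem continuous_frobSq : Continuous fun A : Matrix (Fin a) (Fin b) ℝ => frobSq A :=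
  continuous_frobInner.comp (continuous_id.prodMk continuous_id)

theorem tendsto_zero_of_frobSq {ι : Type*} {l : Filter ι} {u : ι → Matrix (Fin a) (Fin b) ℝ}
    (h : Tendsto (fun k => frobSq (u k)) l (𝓝 0)) : Tendsto u l (𝓝 0) := by
  refine tendsto_pi_nhds.2 fun i => tendsto_pi_nhds.2 fun j => ?_
  have h1 : Tendsto (fun k => u k i j ^ 2) l (𝓝 0) :=
    squeeze_zero (fun _ => sq_nonneg _) (fun k => sq_le_frobSq (u k) i j) h
  have h2 := h1.sqrt
  simp only [Real.sqrt_sq_eq_abs, Real.sqrt_zero] at h2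
  exact (tendsto_zero_iff_abs_tendsto_zero _).2 h2

end Frobenius

/-- Substitute for differentiation in the first-order conditions of the `W`-step and of the Stiefel
projection. -/
theorem eq_zero_of_forall_nonneg_quadratic {A q : ℝ} (h : ∀ s : ℝ, 0 ≤ s * A + s ^ 2 * q) :
    A = 0 := by
  have := discrim_le_zero (a := q) (b := A) (c := 0) fun s => by linarith [h s]
  rw [discrim] at this
  nlinarith

/-! ### Projections onto the Stiefel manifold -/

section Stiefel

variable {a b : ℕ}

theorem frobSq_of_orthonormal {Q : Matrix (Fin a) (Fin b) ℝ} (hQ : Qᵀ * Q = 1) :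
    frobSq Q = b := by
  simp [frobSq, frobInner, hQ]

theorem IsStiefelProj.frobInner_le {A P Q : Matrix (Fin a) (Fin b) ℝ} (h : IsStiefelProj A P)
    (hQ : Qᵀ * Q = 1) : frobInner Q A ≤ frobInner P A := by
  have := h.2 Q hQ
  rw [frobSq_sub, frobSq_sub, frobSq_of_orthonormal hQ, frobSq_of_orthonormal h.1] at this
  linarith

/-- The Cayley-type rotation `1 + 2 s / (1 + s²) Ω + 2 s² / (1 + s²) Ω²`. -/
theorem orthogonal_of_skew {Ω : Matrix (Fin a) (Fin a) ℝ} (hΩ : Ωᵀ = -Ω) (hΩ3 : Ω * Ω * Ω = -Ω)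
    (s : ℝ) :
    (1 + (2 * s / (1 + s ^ 2)) • Ω + (2 * s ^ 2 / (1 + s ^ 2)) • (Ω * Ω))ᵀ *
      (1 + (2 * s / (1 + s ^ 2)) • Ω + (2 * s ^ 2 / (1 + s ^ 2)) • (Ω * Ω)) = 1 := by
  -- With `s = tan (θ / 2)`, these are `x = sin θ` and `y = 1 - cos θ` in Rodrigues' formula; `hxy`
  -- is `sin² + cos² = 1`.
  set x := 2 * s / (1 + s ^ 2) with hx
  set y := 2 * s ^ 2 / (1 + s ^ 2) with hy
  have hxy : 2 * y - x ^ 2 - y ^ 2 = 0 := by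
    rw [hx, hy]
    have : 1 + s ^ 2 ≠ 0 := by positivity
    field_simp
    ring
  have h4 : Ω * Ω * (Ω * Ω) = -(Ω * Ω) := by
    rw [← Matrix.mul_assoc, hΩ3, Matrix.neg_mul]
  have h3 : Ω * (Ω * Ω) = -Ω := by rw [← Matrix.mul_assoc, hΩ3]
  simp only [Matrix.transpose_add, Matrix.transpose_one, Matrix.transpose_smul,
    Matrix.transpose_mul, hΩ, Matrix.neg_mul, Matrix.mul_neg, neg_neg, Matrix.add_mul,
    Matrix.mul_add, Matrix.smul_mul, Matrix.mul_smul, h4, h3, hΩ3, Matrix.one_mul, Matrix.mul_one]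
  have : (1 : Matrix (Fin a) (Fin a) ℝ) = 1 + (2 * y - x ^ 2 - y ^ 2) • (Ω * Ω) := by
    rw [hxy, zero_smul, add_zero]
  conv_rhs => rw [this]
  module

/-- All competitors have the same norm, so `P` maximizes the inner product with `A`. Comparing `P`
with its rotations in the coordinate plane `(i, j)` makes the first-order term vanish, and that term
is the difference of the `(i, j)` and `(j, i)` entries of `A * Pᵀ`. -/
theorem IsStiefelProj.mul_transpose_symm {A P : Matrix (Fin a) (Fin b) ℝ} (h : IsStiefelProj A P) :
    (A * Pᵀ)ᵀ = A * Pᵀ := by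
  ext j i
  rw [Matrix.transpose_apply]
  by_cases hij : i = j
  · rw [hij]
  set Ω : Matrix (Fin a) (Fin a) ℝ := Matrix.single i j 1 - Matrix.single j i 1 with hΩdef
  have hΩ : Ωᵀ = -Ω := by simp [hΩdef]
  have hji : j ≠ i := fun h => hij h.symm
  have hΩ3 : Ω * Ω * Ω = -Ω := by
    simp [hΩdef, Matrix.sub_mul, Matrix.mul_sub, hij, hji]
    abel
  have key : ∀ s : ℝ, 0 ≤ s * (-frobInner A (Ω * P)) + s ^ 2 * (-frobInner A (Ω * Ω * P)) := by
    intro s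
    set x := 2 * s / (1 + s ^ 2) with hx
    set y := 2 * s ^ 2 / (1 + s ^ 2) with hy
    have hR := orthogonal_of_skew hΩ hΩ3 s
    have hs : 0 < 1 + s ^ 2 := by positivity
    have h1 := h.frobInner_le (Q := (1 + x • Ω + y • (Ω * Ω)) * P) (by
      rw [Matrix.transpose_mul, Matrix.mul_assoc, ← Matrix.mul_assoc _ _ P, hR, Matrix.one_mul, h.1])
    rw [frobInner_comm, frobInner_comm P] at h1
    simp only [Matrix.add_mul, Matrix.one_mul, Matrix.smul_mul, frobInner_add_right,
      frobInner_smul_right] at h1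
    have h2 : x * frobInner A (Ω * P) + y * frobInner A (Ω * Ω * P) ≤ 0 := by linarith
    have h3 : x * frobInner A (Ω * P) + y * frobInner A (Ω * Ω * P) =
        2 / (1 + s ^ 2) * (s * frobInner A (Ω * P) + s ^ 2 * frobInner A (Ω * Ω * P)) := by
      rw [hx, hy]
      ring
    rw [h3] at h2
    have h4 := nonpos_of_mul_nonpos_right h2 (by positivity)
    linarith
  have h5 := eq_zero_of_forall_nonneg_quadratic key
  rw [frobInner_mul_left, neg_eq_zero, hΩdef, frobInner_sub_right] at h5
  have hsingle : ∀ (M : Matrix (Fin a) (Fin a) ℝ) (i j : Fin a),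
      frobInner M (Matrix.single i j 1) = M i j := by
    intro M i j
    rw [frobInner, Matrix.trace_mul_single]
    simp
  rw [hsingle, hsingle] at h5
  linarith

/-- First-order optimality of a projected gradient step that does not move. -/
theorem IsStiefelProj.exists_multiplier {P V : Matrix (Fin a) (Fin b) ℝ} {η : ℝ} (hη : η ≠ 0)
    (h : IsStiefelProj (P - η • V) P) :
    ∃ Λ : Matrix (Fin b) (Fin b) ℝ, Λᵀ = Λ ∧ V + P * Λ = 0 := by
  have h1 := h.mul_transpose_symm
  -- The symmetric part `P * Pᵀ` cancels from both sides, leaving the symmetry of `V * Pᵀ`.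
  have h2 : P * Vᵀ = V * Pᵀ := by
    simp only [Matrix.sub_mul, Matrix.smul_mul, Matrix.transpose_sub, Matrix.transpose_smul,
      Matrix.transpose_mul, Matrix.transpose_transpose] at h1
    exact smul_right_injective _ hη (sub_right_injective h1)
  have h3 : V = P * (Vᵀ * P) := by
    rw [← Matrix.mul_assoc, h2, Matrix.mul_assoc, h.1, Matrix.mul_one]
  refine ⟨-(Vᵀ * P), ?_, ?_⟩
  · have h4 : Pᵀ * V = Vᵀ * P := by
      conv_lhs => rw [h3]
      rw [← Matrix.mul_assoc, h.1, Matrix.one_mul]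
    rw [Matrix.transpose_neg, Matrix.transpose_mul, Matrix.transpose_transpose, h4]
  · rw [Matrix.mul_neg, ← h3, add_neg_cancel]

end Stiefel

namespace FedProblem

variable {m d c : ℕ} {n : Fin m → ℕ} (D : FedProblem m d c n)

/-! ### Estimates for the local objective -/

theorem localObj_sub_smul (t : Fin m) (W V : Matrix (Fin d) (Fin c) ℝ)
    (F : Matrix (Fin (n t)) (Fin c) ℝ) (s : ℝ) :
    D.localObj t (W - s • V) F = D.localObj t W F - s * frobInner (D.gradW t W F) V +
      s ^ 2 * (D.ω t * D.α * frobSq (D.X t * V)) := by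
  simp only [localObj, gradW, frobSq, Matrix.mul_sub, Matrix.mul_smul, frobInner_smul_left,
    frobInner_transpose_mul_left, frobInner_sub_left, frobInner_sub_right, frobInner_smul_right,
    frobInner_comm (D.X t * V) _, frobInner_comm (D.X t * W) F]
  ring

/-- Exact because the objective is quadratic. The change in `F` is measured at `w`, the model at
which sufficient decrease is available; the terms in `L t` cancel, so only cross terms through `X t`
remain. -/
theorem localObj_descent_identity (t : Fin m) (z z' w : Matrix (Fin d) (Fin c) ℝ)
    (F F' : Matrix (Fin (n t)) (Fin c) ℝ) :
    D.localObj t z' F' - D.localObj t z F = frobInner (D.gradW t w F) (z' - z) +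
      (D.localObj t w F' - D.localObj t w F) + 2 * D.ω t * D.α *
      (-frobInner (D.X t * (z' - z)) (D.X t * (w - z)) - frobInner (D.X t * (z' - z)) (F' - F) +
        frobInner (F' - F) (D.X t * (w - z)) + frobSq (D.X t * (z' - z)) / 2) := by
  simp only [localObj, gradW, frobSq, Matrix.mul_sub, frobInner_smul_left,
    frobInner_transpose_mul_left, frobInner_sub_left, frobInner_sub_right,
    frobInner_comm (D.X t * z') (D.X t * z), frobInner_comm (D.X t * w) (D.X t * z),
    frobInner_comm (D.X t * z') (D.X t * w), frobInner_comm (D.X t * z) F,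
    frobInner_comm (D.X t * z) F', frobInner_comm (D.X t * z') F, frobInner_comm (D.X t * z') F',
    frobInner_comm (D.X t * w) F, frobInner_comm (D.X t * w) F']
  ring

theorem exists_localObj_descent (t : Fin m) {μ : ℝ} (hμ : 0 < μ) :
    ∃ C : ℝ, 0 ≤ C ∧ ∀ (z z' w : Matrix (Fin d) (Fin c) ℝ) (F F' : Matrix (Fin (n t)) (Fin c) ℝ),
      D.localObj t z' F' - D.localObj t z F ≤ frobInner (D.gradW t w F) (z' - z) +
        (D.localObj t w F' - D.localObj t w F) + C * (frobSq (z' - z) + frobSq (w - z)) +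
        μ * frobSq (F' - F) := by
  set q := 2 * D.ω t * D.α with hq
  have hq0 : 0 ≤ q := mul_nonneg (mul_nonneg two_pos.le (D.ω_nonneg t)) D.α_nonneg
  refine ⟨(q + q ^ 2 / (2 * μ)) * frobSq (D.X t),
    mul_nonneg (by positivity) (frobSq_nonneg _), fun z z' w F F' => ?_⟩
  rw [D.localObj_descent_identity t z z' w F F', ← hq]
  set u := D.X t * (z' - z)
  set v := D.X t * (w - z)
  have hu : frobSq u ≤ frobSq (D.X t) * frobSq (z' - z) := frobSq_mul_le _ _
  have hv : frobSq v ≤ frobSq (D.X t) * frobSq (w - z) := frobSq_mul_le _ _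
  have h1 := mul_le_mul_of_nonneg_left (neg_two_mul_frobInner_le u v) hq0
  have young : ∀ A B : Matrix (Fin (n t)) (Fin c) ℝ,
      q * (2 * frobInner A B) ≤ μ * frobSq A + q ^ 2 / μ * frobSq B := by
    intro A B
    have h := two_mul_frobInner_le (√μ • A) ((q / √μ) • B)
    rw [frobSq_smul, frobSq_smul, frobInner_smul_left, frobInner_smul_right, div_pow,
      Real.sq_sqrt hμ.le] at h
    have h' : 2 * (√μ * (q / √μ * frobInner A B)) = q * (2 * frobInner A B) := by
      have : √μ ≠ 0 := (Real.sqrt_pos.2 hμ).ne'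
      field_simp
    linarith
  have h2 := young (F' - F) (-u)
  have h3 := young (F' - F) v
  have hneg : frobSq (-u) = frobSq u := by
    rw [← neg_one_smul ℝ u, frobSq_smul]
    norm_num
  rw [hneg, frobInner_comm, frobInner_neg_left] at h2
  have h4 := mul_le_mul_of_nonneg_left (add_le_add hu hv)
    (show 0 ≤ q + q ^ 2 / (2 * μ) by positivity)
  have h5 : q ^ 2 / μ = 2 * (q ^ 2 / (2 * μ)) := by
    field_simp
  rw [h5] at h2 h3
  have h6 := mul_nonneg hq0 (frobSq_nonneg v)
  nlinarith

theorem exists_frobSq_gradW_sub_le (t : Fin m) :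
    ∃ K : ℝ, 0 ≤ K ∧ ∀ (ρ : ℝ), K ≤ ρ ^ 2 →
      ∀ (z w z' w' : Matrix (Fin d) (Fin c) ℝ) (F F' : Matrix (Fin (n t)) (Fin c) ℝ),
      ρ • (w' - z') = D.gradW t w F - D.gradW t w' F' + ρ • (z' - z) →
      ρ ^ 2 * frobSq (w' - z') ≤ ρ ^ 2 * (frobSq (w - z) / 2 + 6 * frobSq (z' - z)) +
        K * frobSq (F' - F) := by
  set q := 2 * D.ω t * D.α with hq
  set X := D.X t with hX
  set κ := max (q ^ 2 * (frobSq Xᵀ * frobSq X)) (q ^ 2 * frobSq Xᵀ)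
  have hκ0 : 0 ≤ κ := le_max_of_le_right (mul_nonneg (sq_nonneg _) (frobSq_nonneg _))
  refine ⟨40 * κ, by positivity, fun ρ hρ z w z' w' F F' h => ?_⟩
  have hB : ∀ V : Matrix (Fin d) (Fin c) ℝ, frobSq (q • (Xᵀ * (X * V))) ≤ κ * frobSq V := by
    intro V
    rw [frobSq_smul]
    refine le_trans ?_ (mul_le_mul_of_nonneg_right (le_max_left _ _) (frobSq_nonneg V))
    rw [mul_assoc, mul_assoc]
    exact mul_le_mul_of_nonneg_left ((frobSq_mul_le _ _).trans
      (mul_le_mul_of_nonneg_left (frobSq_mul_le _ _) (frobSq_nonneg _))) (sq_nonneg _)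
  have hF : ∀ V : Matrix (Fin (n t)) (Fin c) ℝ, frobSq (q • (Xᵀ * V)) ≤ κ * frobSq V := by
    intro V
    rw [frobSq_smul]
    refine le_trans ?_ (mul_le_mul_of_nonneg_right (le_max_right _ _) (frobSq_nonneg V))
    rw [mul_assoc]
    exact mul_le_mul_of_nonneg_left (frobSq_mul_le _ _) (sq_nonneg _)
  -- The gradient difference is split along `w - w' = (w - z) + (z - z') + (z' - w')`.
  -- Cauchy–Schwarz over five terms costs a factor 5; since `5 κ ≤ ρ² / 8`, the term in `w' - z'` is
  -- absorbed on the left.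
  let V : Fin 5 → Matrix (Fin d) (Fin c) ℝ := ![q • (Xᵀ * (X * (w - z))),
    q • (Xᵀ * (X * (z' - w'))), q • (Xᵀ * (X * (z - z'))), q • (Xᵀ * (F' - F)), ρ • (z' - z)]
  have hsum : ρ • (w' - z') = ∑ i, V i := by
    rw [h]
    simp only [V, Fin.sum_univ_five, Matrix.cons_val, gradW, ← hq, ← hX, Matrix.mul_sub]
    module
  have h1 := frobSq_sum_le Finset.univ V
  rw [← hsum, frobSq_smul] at h1
  simp only [V, Fin.sum_univ_five, Matrix.cons_val, Finset.card_univ, Fintype.card_fin] at h1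
  rw [frobSq_smul ρ] at h1
  have h2 := hB (w - z)
  have h3 := hB (z' - w')
  have h4 := hB (z - z')
  have h5 := hF (F' - F)
  rw [frobSq_sub_comm z' w'] at h3
  rw [frobSq_sub_comm z z'] at h4
  push_cast at h1
  have m1 := mul_le_mul_of_nonneg_right hρ (frobSq_nonneg (w - z))
  have m2 := mul_le_mul_of_nonneg_right hρ (frobSq_nonneg (w' - z'))
  have m3 := mul_le_mul_of_nonneg_right hρ (frobSq_nonneg (z' - z))
  have m4 := mul_nonneg hκ0 (frobSq_nonneg (F' - F))
  have m5 := mul_nonneg (sq_nonneg ρ) (frobSq_nonneg (w - z))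
  have m6 := mul_nonneg (sq_nonneg ρ) (frobSq_nonneg (z' - z))
  linarith

theorem continuous_reg : Continuous D.reg :=
  continuous_const.mul (continuous_stackSchattenPow D.mode D.p_pos)

theorem reg_nonneg (Z : ModelStack m d c) : 0 ≤ D.reg Z :=
  mul_nonneg D.β_pos.le (stackSchattenPow_nonneg _ _ _)

theorem exists_abs_le_of_reg_le (M : ℝ) :
    ∃ R : ℝ, ∀ Z : ModelStack m d c, D.reg Z ≤ M → ∀ t i j, |Z t i j| ≤ R := by
  obtain ⟨R, hR⟩ := exists_abs_le_of_stackSchattenPow_le m d c D.mode D.p_pos (M / D.β)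
  exact ⟨R, fun Z hZ => hR Z ((le_div_iff₀' D.β_pos).2 hZ)⟩

/-- `L t` need not be positive semidefinite; the bound comes from `frobSq F = c` alone. -/
theorem neg_le_localObj_of_orthonormal (t : Fin m) (W : Matrix (Fin d) (Fin c) ℝ)
    {F : Matrix (Fin (n t)) (Fin c) ℝ} (hF : Fᵀ * F = 1) :
    -(D.ω t * ((c + frobSq (D.L t) * c) / 2)) ≤ D.localObj t W F := by
  have h1 := neg_two_mul_frobInner_le F (D.L t * F)
  have h2 := frobSq_mul_le (D.L t) F
  rw [frobSq_of_orthonormal hF] at h1 h2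
  have h3 := mul_nonneg D.α_nonneg (frobSq_nonneg (F - D.X t * W))
  have h4 : (Fᵀ * D.L t * F).trace = frobInner F (D.L t * F) := by
    rw [frobInner, Matrix.mul_assoc]
  rw [localObj, h4, ← mul_neg]
  exact mul_le_mul_of_nonneg_left (by linarith) (D.ω_nonneg t)

variable {D} {ρ cF : ℝ} {J : ℕ} {η : Fin m → ℝ} {W Z Y : ℕ → ModelStack m d c}
  {F : ℕ → EmbeddingStack n c} {G : ℕ → (t : Fin m) → ℕ → Matrix (Fin (n t)) (Fin c) ℝ}

/-! ### Consequences of the individual steps -/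

theorem IsRun.gradW_add_eq_zero (h : D.IsRun ρ J η W F G Z Y) (k : ℕ) (t : Fin m) :
    D.gradW t (W (k + 1) t) (F k t) + Y k t + ρ • (W (k + 1) t - Z k t) = 0 := by
  -- The perturbation direction is the residual itself, so the linear coefficient is minus its
  -- squared norm.
  set V : ModelStack m d c := fun t =>
    D.gradW t (W (k + 1) t) (F k t) + Y k t + ρ • (W (k + 1) t - Z k t)
  have key : ∀ s : ℝ, 0 ≤ s * (-∑ t, frobSq (V t)) + s ^ 2 *
      ∑ t, (D.ω t * D.α * frobSq (D.X t * V t) + ρ / 2 * frobSq (V t)) := by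
    intro s
    have h1 := h.W_step k (fun t => W (k + 1) t - s • V t)
    simp only [augLagrangian, localObj_sub_smul] at h1
    have h2 : ∀ t, frobInner (Y k t) (W (k + 1) t - s • V t - Z k t) +
        ρ / 2 * frobSq (W (k + 1) t - s • V t - Z k t) =
        frobInner (Y k t) (W (k + 1) t - Z k t) + ρ / 2 * frobSq (W (k + 1) t - Z k t) -
        s * frobInner (Y k t + ρ • (W (k + 1) t - Z k t)) (V t) +
        s ^ 2 * (ρ / 2 * frobSq (V t)) := by
      intro t
      rw [sub_right_comm, frobSq_sub, frobInner_sub_right, frobInner_smul_right,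
        frobInner_add_left, frobInner_smul_left, frobInner_smul_right, frobSq_smul]
      ring
    have h3 : ∀ t, frobSq (V t) = frobInner (D.gradW t (W (k + 1) t) (F k t)) (V t) +
        frobInner (Y k t + ρ • (W (k + 1) t - Z k t)) (V t) := by
      intro t
      rw [← frobInner_add_left, ← add_assoc]
      rfl
    simp only [h2] at h1
    simp only [Finset.sum_add_distrib, Finset.sum_sub_distrib, ← Finset.mul_sum] at h1 ⊢
    have h4 := congrArg (s * ·) (Finset.sum_congr (s₁ := Finset.univ) rfl fun t _ => h3 t)
    simp only [Finset.sum_add_distrib] at h4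
    linarith
  have h0 := eq_zero_of_forall_nonneg_quadratic key
  rw [neg_eq_zero, Finset.sum_eq_zero_iff_of_nonneg fun t _ => frobSq_nonneg _] at h0
  exact eq_zero_of_frobSq_eq_zero (h0 t (Finset.mem_univ t))

theorem IsRun.Y_succ (h : D.IsRun ρ J η W F G Z Y) (k : ℕ) (t : Fin m) :
    Y (k + 1) t = ρ • (Z k t - Z (k + 1) t) - D.gradW t (W (k + 1) t) (F k t) := by
  have h1 : Y k t = -(D.gradW t (W (k + 1) t) (F k t)) - ρ • (W (k + 1) t - Z k t) := by
    rw [← sub_eq_zero, ← h.gradW_add_eq_zero k t]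
    abel
  rw [h.Y_step, h1]
  module

/-- Expanding the penalty around `Z (k + 1)` turns `Y k` into `Y (k + 1)`: the dual update adds
exactly the gradient of the penalty. -/
theorem IsRun.reg_le (h : D.IsRun ρ J η W F G Z Y) (k : ℕ) (Z' : ModelStack m d c) :
    D.reg (Z (k + 1)) + (∑ t, frobInner (Y (k + 1) t) (Z' t - Z (k + 1) t)) -
      ρ / 2 * ∑ t, frobSq (Z' t - Z (k + 1) t) ≤ D.reg Z' := by
  have h1 := h.Z_step k Z'
  simp only [augLagrangian] at h1
  have h2 : ∀ t, frobInner (Y k t) (W (k + 1) t - Z' t) +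
      ρ / 2 * frobSq (W (k + 1) t - Z' t) =
      frobInner (Y k t) (W (k + 1) t - Z (k + 1) t) + ρ / 2 * frobSq (W (k + 1) t - Z (k + 1) t) -
      frobInner (Y (k + 1) t) (Z' t - Z (k + 1) t) + ρ / 2 * frobSq (Z' t - Z (k + 1) t) := by
    intro t
    rw [h.Y_step, ← sub_sub_sub_cancel_right (W (k + 1) t) (Z' t) (Z (k + 1) t), frobSq_sub,
      frobInner_sub_right, frobInner_add_left, frobInner_smul_left]
    ring
  simp only [h2] at h1
  simp only [Finset.sum_add_distrib, Finset.sum_sub_distrib, ← Finset.mul_sum] at h1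
  linarith

theorem IsRun.reg_succ_le (h : D.IsRun ρ J η W F G Z Y) (k : ℕ) :
    D.reg (Z (k + 1)) + (∑ t, frobInner (D.gradW t (W (k + 1) t) (F k t)) (Z (k + 1) t - Z k t)) +
      ρ / 2 * ∑ t, frobSq (Z (k + 1) t - Z k t) ≤ D.reg (Z k) := by
  refine le_trans (le_of_eq ?_) (h.reg_le k (Z k))
  rw [add_assoc, add_sub_assoc, Finset.mul_sum, Finset.mul_sum, ← Finset.sum_add_distrib,
    ← Finset.sum_sub_distrib]
  congr 1
  refine Finset.sum_congr rfl fun t _ => ?_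
  rw [h.Y_succ, frobSq_sub_comm (Z k t), ← neg_sub (Z (k + 1) t) (Z k t)]
  rw [← neg_one_smul ℝ (Z (k + 1) t - Z k t), frobInner_smul_right, frobInner_sub_left,
    frobInner_smul_left, frobInner_smul_left, frobSq]
  ring

/-- The quadratic defect `ρ/2 r²` in `IsRun.reg_le` is at most `ε r` once `r < ε / ρ`. -/
theorem IsRun.regularSubgradient (h : D.IsRun ρ J η W F G Z Y) (hρ : 0 < ρ) (k : ℕ) :
    IsRegularSubgradient D.reg (Z (k + 1)) (Y (k + 1)) := by
  intro ε hε
  have hcont : Continuous fun Z' : ModelStack m d c => stackNorm (Z' - Z (k + 1)) := by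
    unfold stackNorm stackInner
    refine (continuous_finsetSum _ fun t _ => ?_).sqrt
    exact continuous_frobSq.comp (((continuous_apply t).sub continuous_const))
  have h0 : stackNorm (Z (k + 1) - Z (k + 1)) < ε / ρ := by
    have : stackNorm (Z (k + 1) - Z (k + 1)) = 0 := by
      simp [stackNorm, stackInner, frobInner]
    rw [this]
    positivity
  filter_upwards [hcont.continuousAt.eventually_lt_const h0] with Z' hZ'
  refine le_trans ?_ (h.reg_le k Z')
  have h1 : stackNorm (Z' - Z (k + 1)) ^ 2 = ∑ t, frobSq (Z' t - Z (k + 1) t) :=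
    Real.sq_sqrt (Finset.sum_nonneg fun t _ => frobSq_nonneg _)
  rw [← h1]
  change _ + stackInner (Y (k + 1)) (Z' - Z (k + 1)) - _ ≤
    _ + stackInner (Y (k + 1)) (Z' - Z (k + 1)) - _
  have h2 : 0 ≤ stackNorm (Z' - Z (k + 1)) := Real.sqrt_nonneg _
  rw [lt_div_iff₀ hρ] at hZ'
  nlinarith

theorem IsRun.orthonormal (h : D.IsRun ρ J η W F G Z Y) (hJ : 1 ≤ J) (k : ℕ) (t : Fin m) :
    (F (k + 1) t)ᵀ * F (k + 1) t = 1 := by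
  obtain ⟨j, rfl⟩ := Nat.exists_eq_add_of_le' hJ
  rw [h.F_end]
  exact (h.F_step k t j (Nat.lt_succ_self j)).1

/-- Only the `t`-th local term of the augmented Lagrangian involves `F t`. The clients decouple, and
the penalty disappears from the hypothesis. -/
theorem localObj_le_of_sufficientDecrease (hS : D.SufficientDecrease cF ρ J W F G Z Y) (k : ℕ)
    (t : Fin m) {j : ℕ} (hj : j < J) :
    D.localObj t (W (k + 1) t) (G k t (j + 1)) ≤ D.localObj t (W (k + 1) t) (G k t j) -
      cF / 2 * frobSq (G k t (j + 1) - G k t j) := by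
  have h1 := hS k t j hj
  simp only [augLagrangian] at h1
  have h2 : ∀ A : Matrix (Fin (n t)) (Fin c) ℝ,
      ∑ s, D.localObj s (W (k + 1) s) (Function.update (F k) t A s) =
      D.localObj t (W (k + 1) t) A +
        ∑ s ∈ Finset.univ.erase t, D.localObj s (W (k + 1) s) (F k s) := by
    intro A
    rw [← Finset.add_sum_erase _ _ (Finset.mem_univ t), Function.update_self]
    congr 1
    refine Finset.sum_congr rfl fun s hs => ?_
    rw [Function.update_of_ne (Finset.ne_of_mem_erase hs)]
  rw [h2, h2] at h1
  linarith

theorem IsRun.localObj_succ_le (h : D.IsRun ρ J η W F G Z Y)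
    (hS : D.SufficientDecrease cF ρ J W F G Z Y) (k : ℕ) (t : Fin m) :
    D.localObj t (W (k + 1) t) (F (k + 1) t) ≤ D.localObj t (W (k + 1) t) (F k t) -
      cF / 2 * ∑ j ∈ Finset.range J, frobSq (G k t (j + 1) - G k t j) := by
  have h1 : ∀ N ≤ J, D.localObj t (W (k + 1) t) (G k t N) ≤ D.localObj t (W (k + 1) t) (G k t 0) -
      cF / 2 * ∑ j ∈ Finset.range N, frobSq (G k t (j + 1) - G k t j) := by
    intro N
    induction N with
    | zero => simp
    | succ N ih =>
      intro hN
      rw [Finset.sum_range_succ]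
      have := localObj_le_of_sufficientDecrease hS k t hN
      have := ih (Nat.le_of_succ_le hN)
      linarith
  rw [h.F_end, ← h.F_start k t]
  exact h1 J le_rfl

theorem IsRun.frobSq_F_succ_sub_le (h : D.IsRun ρ J η W F G Z Y) (k : ℕ) (t : Fin m) :
    frobSq (F (k + 1) t - F k t) ≤
      J * ∑ j ∈ Finset.range J, frobSq (G k t (j + 1) - G k t j) := by
  have h1 := frobSq_sum_le (Finset.range J) fun j => G k t (j + 1) - G k t j
  rwa [Finset.sum_range_sub, ← h.F_end, h.F_start, Finset.card_range] at h1

end FedProblem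

/-! ### Summability, compactness and closedness of the projection relation. -/

theorem tendsto_zero_of_descent {u v : ℕ → ℝ} {θ B : ℝ} (hθ : 0 < θ) (hv : ∀ k, 0 ≤ v k)
    (hu : ∀ k, u (k + 1) + θ * v k ≤ u k) (hB : ∀ k, B ≤ u k) : Tendsto v atTop (𝓝 0) := by
  have h1 : ∀ N, ∑ k ∈ Finset.range N, v k ≤ (u 0 - B) / θ := by
    intro N
    rw [le_div_iff₀' hθ, Finset.mul_sum]
    refine (Finset.sum_le_sum fun k _ => le_sub_iff_add_le'.2 (hu k)).trans ?_
    rw [Finset.sum_range_sub']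
    linarith [hB N]
  exact (summable_of_sum_range_le hv h1).tendsto_atTop_zero

theorem isCompact_setOf_abs_le {m b : ℕ} (a : Fin m → ℕ) (R : ℝ) :
    IsCompact {V : (t : Fin m) → Matrix (Fin (a t)) (Fin b) ℝ | ∀ t i j, |V t i j| ≤ R} := by
  have h : IsCompact (Set.pi Set.univ fun t : Fin m => (Set.pi Set.univ fun _ : Fin (a t) =>
      Set.pi Set.univ fun _ : Fin b => Set.Icc (-R) R)) :=
    isCompact_univ_pi fun t => isCompact_univ_pi fun i => isCompact_univ_pi fun j => isCompact_Icc
  refine (congrArg IsCompact (Set.ext fun V => ?_)).mp h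
  simp only [Set.mem_ofPred_eq, abs_le]
  exact ⟨fun hV t i j => hV t trivial i trivial j trivial, fun hV t _ i _ j _ => hV t i j⟩

instance Matrix.firstCountableTopology {a b : Type*} [Finite a] [Finite b] :
    FirstCountableTopology (Matrix a b ℝ) :=
  inferInstanceAs (FirstCountableTopology (a → b → ℝ))

theorem IsStiefelProj.of_tendsto {a b : ℕ} {A P : ℕ → Matrix (Fin a) (Fin b) ℝ}
    {A' P' : Matrix (Fin a) (Fin b) ℝ} (h : ∀ i, IsStiefelProj (A i) (P i))
    (hA : Tendsto A atTop (𝓝 A')) (hP : Tendsto P atTop (𝓝 P')) : IsStiefelProj A' P' := by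
  refine ⟨?_, fun Q hQ => ?_⟩
  · have hc : Continuous fun P : Matrix (Fin a) (Fin b) ℝ => Pᵀ * P := by fun_prop
    refine tendsto_nhds_unique ((hc.tendsto P').comp hP) ?_
    exact tendsto_const_nhds.congr fun i => ((h i).1).symm
  · exact le_of_tendsto_of_tendsto' ((continuous_frobSq.tendsto _).comp (hP.sub hA))
      ((continuous_frobSq.tendsto _).comp (tendsto_const_nhds.sub hA)) fun i => (h i).2 Q hQ

/-! ### The energy and the step lengths of a round. -/

namespace FedProblem

variable {m d c : ℕ} {n : Fin m → ℕ} (D : FedProblem m d c n)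

/-- The objective of the problem. -/
noncomputable def energy (Z : ModelStack m d c) (F : EmbeddingStack n c) : ℝ :=
  ∑ t, D.localObj t (Z t) (F t) + D.reg Z

theorem continuous_gradW (t : Fin m) :
    Continuous fun x : Matrix (Fin d) (Fin c) ℝ × Matrix (Fin (n t)) (Fin c) ℝ =>
      D.gradW t x.1 x.2 := by
  unfold gradW
  fun_prop

theorem continuous_gradF (t : Fin m) :
    Continuous fun x : Matrix (Fin d) (Fin c) ℝ × Matrix (Fin (n t)) (Fin c) ℝ =>
      D.gradF t x.1 x.2 := by
  unfold gradF
  fun_prop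

theorem exists_reg_sub_le_energy :
    ∃ B : ℝ, ∀ (Z : ModelStack m d c) (F : EmbeddingStack n c), (∀ t, (F t)ᵀ * F t = 1) →
      D.reg Z - B ≤ D.energy Z F := by
  refine ⟨∑ t, D.ω t * ((c + frobSq (D.L t) * c) / 2), fun Z F hF => ?_⟩
  have h := Finset.sum_le_sum fun t (_ : t ∈ Finset.univ) =>
    D.neg_le_localObj_of_orthonormal t (Z t) (hF t)
  rw [Finset.sum_neg_distrib] at h
  rw [energy]
  linarith

/-- The square of the distance between the new model and the old consensus copy in round `k`. -/
noncomputable def modelGap (W Z : ℕ → ModelStack m d c) (k : ℕ) : ℝ := ∑ t, frobSq (W (k + 1) t - Z k t)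

/-- The square of the length of the consensus step in round `k`. -/
noncomputable def consensusStep (Z : ℕ → ModelStack m d c) (k : ℕ) : ℝ := ∑ t, frobSq (Z (k + 1) t - Z k t)

/-- The sum of the squares of the lengths of the projected gradient steps in round `k`. -/
noncomputable def embeddingStep (J : ℕ) (G : ℕ → (t : Fin m) → ℕ → Matrix (Fin (n t)) (Fin c) ℝ) (k : ℕ) : ℝ :=
  ∑ t, ∑ j ∈ Finset.range J, frobSq (G k t (j + 1) - G k t j)

theorem modelGap_nonneg (W Z : ℕ → ModelStack m d c) (k : ℕ) : 0 ≤ modelGap W Z k :=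
  Finset.sum_nonneg fun _ _ => frobSq_nonneg _

theorem consensusStep_nonneg (Z : ℕ → ModelStack m d c) (k : ℕ) : 0 ≤ consensusStep Z k :=
  Finset.sum_nonneg fun _ _ => frobSq_nonneg _

theorem embeddingStep_nonneg (J : ℕ)
    (G : ℕ → (t : Fin m) → ℕ → Matrix (Fin (n t)) (Fin c) ℝ) (k : ℕ) : 0 ≤ embeddingStep J G k :=
  Finset.sum_nonneg fun _ _ => Finset.sum_nonneg fun _ _ => frobSq_nonneg _

/-! ### The descent argument -/

theorem exists_energy_descent {J : ℕ} (hJ : 1 ≤ J) {cF : ℝ} (hcF : 0 < cF) :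
    ∃ C : ℝ, 0 ≤ C ∧ ∀ (ρ : ℝ) (η : Fin m → ℝ) (W : ℕ → ModelStack m d c)
      (F : ℕ → EmbeddingStack n c) (G : ℕ → (t : Fin m) → ℕ → Matrix (Fin (n t)) (Fin c) ℝ)
      (Z Y : ℕ → ModelStack m d c), D.IsRun ρ J η W F G Z Y →
      D.SufficientDecrease cF ρ J W F G Z Y → ∀ k,
      D.energy (Z (k + 1)) (F (k + 1)) + ρ / 2 * consensusStep Z k + cF / 4 * embeddingStep J G k ≤
        D.energy (Z k) (F k) + C * (consensusStep Z k + modelGap W Z k) := by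
  have hJ0 : (0 : ℝ) < J := by exact_mod_cast hJ
  -- With `‖ΔF‖² ≤ J * ∑ ‖inner steps‖²`, this weight spends half of the decrease `cF / 2` and
  -- leaves `cF / 4`.
  have hμ : 0 < cF / (4 * J) := by positivity
  choose C hC0 hC using fun t => D.exists_localObj_descent t hμ
  refine ⟨∑ t, C t, Finset.sum_nonneg fun t _ => hC0 t, fun ρ η W F G Z Y h hS k => ?_⟩
  have key : ∀ t, D.localObj t (Z (k + 1) t) (F (k + 1) t) +
      cF / 4 * (∑ j ∈ Finset.range J, frobSq (G k t (j + 1) - G k t j)) ≤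
      D.localObj t (Z k t) (F k t) +
      frobInner (D.gradW t (W (k + 1) t) (F k t)) (Z (k + 1) t - Z k t) +
      (∑ s, C s) * (frobSq (Z (k + 1) t - Z k t) + frobSq (W (k + 1) t - Z k t)) := by
    intro t
    have h1 := hC t (Z k t) (Z (k + 1) t) (W (k + 1) t) (F k t) (F (k + 1) t)
    have h2 := h.localObj_succ_le hS k t
    have h3 := mul_le_mul_of_nonneg_left (h.frobSq_F_succ_sub_le k t) hμ.le
    have hμJ : cF / (4 * J) * J = cF / 4 := by field_simp
    rw [← mul_assoc, hμJ] at h3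
    have h4 := mul_le_mul_of_nonneg_right
      (Finset.single_le_sum (fun s _ => hC0 s) (Finset.mem_univ t))
      (add_nonneg (frobSq_nonneg (Z (k + 1) t - Z k t)) (frobSq_nonneg (W (k + 1) t - Z k t)))
    linarith
  have h5 := Finset.sum_le_sum fun t (_ : t ∈ Finset.univ) => key t
  simp only [Finset.sum_add_distrib, ← Finset.mul_sum] at h5
  have h6 := h.reg_succ_le k
  simp only [energy, consensusStep, modelGap, embeddingStep]
  linarith

theorem exists_modelGap_recursion (J : ℕ) :
    ∃ K : ℝ, 0 ≤ K ∧ ∀ (ρ : ℝ), K ≤ ρ ^ 2 → ∀ (η : Fin m → ℝ) (W : ℕ → ModelStack m d c)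
      (F : ℕ → EmbeddingStack n c) (G : ℕ → (t : Fin m) → ℕ → Matrix (Fin (n t)) (Fin c) ℝ)
      (Z Y : ℕ → ModelStack m d c), D.IsRun ρ J η W F G Z Y → ∀ k,
      ρ ^ 2 * modelGap W Z (k + 1) ≤
        ρ ^ 2 * (modelGap W Z k / 2 + 6 * consensusStep Z k) + K * (J * embeddingStep J G k) := by
  choose K hK0 hK using fun t => D.exists_frobSq_gradW_sub_le t
  refine ⟨∑ t, K t, Finset.sum_nonneg fun t _ => hK0 t, fun ρ hρ η W F G Z Y h k => ?_⟩
  have key : ∀ t, ρ ^ 2 * frobSq (W (k + 1 + 1) t - Z (k + 1) t) ≤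
      ρ ^ 2 * (frobSq (W (k + 1) t - Z k t) / 2 + 6 * frobSq (Z (k + 1) t - Z k t)) +
      (∑ s, K s) * (J * ∑ j ∈ Finset.range J, frobSq (G k t (j + 1) - G k t j)) := by
    intro t
    have hle := Finset.single_le_sum (fun s _ => hK0 s) (Finset.mem_univ t)
    refine (hK t ρ (hle.trans hρ) (Z k t) (W (k + 1) t) (Z (k + 1) t) (W (k + 1 + 1) t) (F k t)
      (F (k + 1) t) ?_).trans ?_
    · have h1 := h.gradW_add_eq_zero (k + 1) t
      rw [h.Y_succ] at h1
      rw [← sub_eq_zero, ← h1]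
      module
    · have h2 := h.frobSq_F_succ_sub_le k t
      gcongr
      · exact frobSq_nonneg _
      · exact Finset.sum_nonneg fun s _ => hK0 s
  have h5 := Finset.sum_le_sum fun t (_ : t ∈ Finset.univ) => key t
  simp only [Finset.sum_add_distrib, ← Finset.mul_sum, ← Finset.sum_div] at h5
  exact h5

theorem exists_asymptotic_regularity {J : ℕ} (hJ : 1 ≤ J) {cF : ℝ} (hcF : 0 < cF) :
    ∃ ρ₁ : ℝ, 0 < ρ₁ ∧ ∀ ρ : ℝ, ρ₁ ≤ ρ → ∀ (η : Fin m → ℝ) (W : ℕ → ModelStack m d c)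
      (F : ℕ → EmbeddingStack n c) (G : ℕ → (t : Fin m) → ℕ → Matrix (Fin (n t)) (Fin c) ℝ)
      (Z Y : ℕ → ModelStack m d c), D.IsRun ρ J η W F G Z Y →
      D.SufficientDecrease cF ρ J W F G Z Y →
      Tendsto (modelGap W Z) atTop (𝓝 0) ∧ Tendsto (consensusStep Z) atTop (𝓝 0) ∧
      Tendsto (embeddingStep J G) atTop (𝓝 0) ∧ ∃ M, ∀ k, D.reg (Z (k + 1)) ≤ M := by
  obtain ⟨C₀, hC₀, hdesc₀⟩ := D.exists_energy_descent hJ hcF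
  obtain ⟨K, hK0, hrec⟩ := D.exists_modelGap_recursion J
  obtain ⟨B, hB⟩ := D.exists_reg_sub_le_energy
  obtain ⟨C, hC, hCC⟩ : ∃ C : ℝ, 0 < C ∧ C₀ ≤ C := ⟨C₀ + 1, by linarith, by linarith⟩
  -- `1` gives `ρ ≤ ρ²`; `76 = 4 (18 + 1)` lets `ρ/4 v k` absorb the `18 C v k` produced by the gap
  -- recursion with `C v k` to spare; `48 = 3 * 16` fits the inner-step error into `cF/16 S k`.
  refine ⟨1 + 76 * C + K + 48 * C * K * J / cF, by positivity,
    fun ρ hρ η W F G Z Y h hS => ?_⟩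
  have hq : 0 ≤ 48 * C * K * J / cF := by positivity
  have hρ1 : 1 ≤ ρ := by linarith
  have hρsq : ρ ≤ ρ ^ 2 := by nlinarith
  have hρ2 : K ≤ ρ ^ 2 := by linarith
  have hρ3 : 76 * C ≤ ρ := by linarith
  have hρ4 : 3 * C * (K * J) ≤ ρ ^ 2 * (cF / 16) := by
    have : 48 * C * K * J / cF ≤ ρ ^ 2 := by linarith
    rw [div_le_iff₀ hcF] at this
    linarith
  set e := modelGap W Z
  set v := consensusStep Z
  set S := embeddingStep J G
  have he0 : ∀ k, 0 ≤ e k := modelGap_nonneg W Z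
  have hv0 : ∀ k, 0 ≤ v k := consensusStep_nonneg Z
  have hS0 : ∀ k, 0 ≤ S k := embeddingStep_nonneg J G
  -- Shifted by one, since `F 0` is arbitrary and only later embeddings are orthonormal.
  let E : ℕ → ℝ := fun k => D.energy (Z (k + 1)) (F (k + 1))
  have hEreg : ∀ k, D.reg (Z (k + 1)) - B ≤ E k := fun k => hB _ _ (h.orthonormal hJ k)
  have hE : ∀ k, -B ≤ E k := fun k => by
    have := hEreg k
    have := D.reg_nonneg (Z (k + 1))
    linarith
  have hdesc : ∀ k, E (k + 1) + ρ / 2 * v (k + 1) + cF / 4 * S (k + 1) ≤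
      E k + C * (v (k + 1) + e (k + 1)) := fun k =>
    (hdesc₀ ρ η W F G Z Y h hS (k + 1)).trans (add_le_add_right
      (mul_le_mul_of_nonneg_right hCC (add_nonneg (hv0 _) (he0 _))) _)
  have hgap : ∀ k, 3 * C * e (k + 1) ≤ 3 * C * (e k / 2 + 6 * v k) + cF / 16 * S k := by
    intro k
    have h1 := mul_le_mul_of_nonneg_left (hrec ρ hρ2 η W F G Z Y h k) (show 0 ≤ 3 * C by positivity)
    have h2 := mul_le_mul_of_nonneg_right hρ4 (hS0 k)
    refine le_of_mul_le_mul_left ?_ (show 0 < ρ ^ 2 by positivity)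
    linarith
  let θ := min (C / 2) (cF / 16)
  have hθ : 0 < θ := lt_min (by positivity) (by positivity)
  -- The coefficient `2 C` and the descent error `C` add up to `3 C e (k+1)`; halving by `hgap`
  -- leaves `3/2 C e k`, less than the `2 C e k` available.
  let u : ℕ → ℝ := fun k => E k + 2 * C * e k + ρ / 4 * v k + cF / 8 * S k
  have hu : ∀ k, u (k + 1) + θ * (e k + v k + S k) ≤ u k := by
    intro k
    have h1 := hdesc k
    have h2 := hgap k
    have h3 : θ * e k ≤ C / 2 * e k := mul_le_mul_of_nonneg_right (min_le_left _ _) (he0 k)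
    have h4 : θ * v k ≤ C / 2 * v k := mul_le_mul_of_nonneg_right (min_le_left _ _) (hv0 k)
    have h5 : θ * S k ≤ cF / 16 * S k := mul_le_mul_of_nonneg_right (min_le_right _ _) (hS0 k)
    have h6 := mul_le_mul_of_nonneg_right hρ3 (hv0 k)
    have h7 := mul_le_mul_of_nonneg_right hρ3 (hv0 (k + 1))
    have h8 := mul_nonneg hC.le (hv0 k)
    have h9 := mul_nonneg hC.le (hv0 (k + 1))
    have h10 := mul_nonneg hcF.le (hS0 (k + 1))
    simp only [u]
    linarith
  have hEu : ∀ k, E k ≤ u k := fun k => by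
    have h1 := mul_nonneg hC.le (he0 k)
    have h2 := mul_nonneg (zero_le_one.trans hρ1) (hv0 k)
    have h3 := mul_nonneg hcF.le (hS0 k)
    simp only [u]
    linarith
  have hlim := tendsto_zero_of_descent hθ
    (fun k => add_nonneg (add_nonneg (he0 k) (hv0 k)) (hS0 k)) hu fun k => (hE k).trans (hEu k)
  have hanti : Antitone u := antitone_nat_of_succ_le fun k => by
    have := mul_nonneg hθ.le (add_nonneg (add_nonneg (he0 k) (hv0 k)) (hS0 k))
    have := hu k
    linarith
  refine ⟨squeeze_zero he0 (fun k => ?_) hlim, squeeze_zero hv0 (fun k => ?_) hlim,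
    squeeze_zero hS0 (fun k => ?_) hlim, u 0 + B, fun k => ?_⟩
  · linarith [hv0 k, hS0 k]
  · linarith [he0 k, hS0 k]
  · linarith [he0 k, hv0 k]
  · linarith [hEreg k, hEu k, hanti (Nat.zero_le k)]

/-! ### Limit points -/

variable {D} {ρ : ℝ} {J : ℕ} {η : Fin m → ℝ} {W Z Y : ℕ → ModelStack m d c}
  {F : ℕ → EmbeddingStack n c} {G : ℕ → (t : Fin m) → ℕ → Matrix (Fin (n t)) (Fin c) ℝ}

theorem tendsto_model_sub (he : Tendsto (modelGap W Z) atTop (𝓝 0)) (t : Fin m) :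
    Tendsto (fun k => W (k + 1) t - Z k t) atTop (𝓝 0) :=
  tendsto_zero_of_frobSq <| squeeze_zero (fun _ => frobSq_nonneg _)
    (fun k => Finset.single_le_sum (f := fun t => frobSq (W (k + 1) t - Z k t))
      (fun _ _ => frobSq_nonneg _) (Finset.mem_univ t)) he

theorem tendsto_consensus_sub (hv : Tendsto (consensusStep Z) atTop (𝓝 0)) (t : Fin m) :
    Tendsto (fun k => Z (k + 1) t - Z k t) atTop (𝓝 0) :=
  tendsto_zero_of_frobSq <| squeeze_zero (fun _ => frobSq_nonneg _)
    (fun k => Finset.single_le_sum (f := fun t => frobSq (Z (k + 1) t - Z k t))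
      (fun _ _ => frobSq_nonneg _) (Finset.mem_univ t)) hv

theorem tendsto_embedding_step (hS : Tendsto (embeddingStep J G) atTop (𝓝 0)) (t : Fin m) {j : ℕ}
    (hj : j < J) : Tendsto (fun k => G k t (j + 1) - G k t j) atTop (𝓝 0) :=
  tendsto_zero_of_frobSq <| squeeze_zero (fun _ => frobSq_nonneg _)
    (fun k => (Finset.single_le_sum (f := fun j => frobSq (G k t (j + 1) - G k t j))
      (fun _ _ => frobSq_nonneg _) (Finset.mem_range.2 hj)).trans
      (Finset.single_le_sum
        (f := fun t => ∑ j ∈ Finset.range J, frobSq (G k t (j + 1) - G k t j))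
        (fun _ _ => Finset.sum_nonneg fun _ _ => frobSq_nonneg _) (Finset.mem_univ t))) hS

theorem IsRun.tendsto_embedding_sub (h : D.IsRun ρ J η W F G Z Y)
    (hS : Tendsto (embeddingStep J G) atTop (𝓝 0)) (t : Fin m) :
    Tendsto (fun k => F (k + 1) t - F k t) atTop (𝓝 0) := by
  have h1 : Tendsto (fun k => ∑ j ∈ Finset.range J, (G k t (j + 1) - G k t j)) atTop
      (𝓝 (∑ _j ∈ Finset.range J, 0)) :=
    tendsto_finsetSum _ fun j hj => tendsto_embedding_step hS t (Finset.mem_range.1 hj)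
  rw [Finset.sum_const_zero] at h1
  refine h1.congr fun k => ?_
  rw [Finset.sum_range_sub, ← h.F_end, h.F_start]

/-- Along a subsequence on which the consensus copies and the embeddings converge, the models and
the multipliers converge as well. -/
theorem IsRun.tendsto_of_tendsto (h : D.IsRun ρ J η W F G Z Y)
    (he : Tendsto (modelGap W Z) atTop (𝓝 0)) (hv : Tendsto (consensusStep Z) atTop (𝓝 0))
    (hS : Tendsto (embeddingStep J G) atTop (𝓝 0)) {ψ : ℕ → ℕ} (hψ : Tendsto ψ atTop atTop)
    {Z' : ModelStack m d c} {F' : EmbeddingStack n c}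
    (hZ : Tendsto (fun i => Z (ψ i + 1)) atTop (𝓝 Z'))
    (hF : Tendsto (fun i => F (ψ i + 1)) atTop (𝓝 F')) :
    Tendsto (fun i => W (ψ i + 1)) atTop (𝓝 Z') ∧
      Tendsto (fun i => Y (ψ i + 1)) atTop (𝓝 fun t => -D.gradW t (Z' t) (F' t)) := by
  have hZt := fun t => tendsto_pi_nhds.1 hZ t
  have hFt := fun t => tendsto_pi_nhds.1 hF t
  have hv' := fun t => (tendsto_consensus_sub hv t).comp hψ
  have hW : ∀ t, Tendsto (fun i => W (ψ i + 1) t) atTop (𝓝 (Z' t)) := by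
    intro t
    have h1 := ((hZt t).sub (hv' t)).add ((tendsto_model_sub he t).comp hψ)
    rw [sub_zero, add_zero] at h1
    refine h1.congr fun i => ?_
    simp only [Function.comp_apply]
    abel
  refine ⟨tendsto_pi_nhds.2 hW, tendsto_pi_nhds.2 fun t => ?_⟩
  have hF0 : Tendsto (fun i => F (ψ i) t) atTop (𝓝 (F' t)) := by
    have h1 := (hFt t).sub ((h.tendsto_embedding_sub hS t).comp hψ)
    rw [sub_zero] at h1
    refine h1.congr fun i => ?_
    simp only [Function.comp_apply]
    abel
  have h2 := ((hv' t).const_smul (-ρ)).sub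
    (((D.continuous_gradW t).tendsto (Z' t, F' t)).comp ((hW t).prodMk_nhds hF0))
  rw [smul_zero, zero_sub] at h2
  refine h2.congr fun i => ?_
  simp only [Function.comp_apply]
  rw [h.Y_succ]
  module

/-- Compactness is needed only for `Z`, by coercivity, and for `F`, by orthonormality; the
convergence of `W` and `Y` follows. -/
theorem IsRun.exists_limitPoint (h : D.IsRun ρ J η W F G Z Y) (hJ : 1 ≤ J)
    (he : Tendsto (modelGap W Z) atTop (𝓝 0)) (hv : Tendsto (consensusStep Z) atTop (𝓝 0))
    (hS : Tendsto (embeddingStep J G) atTop (𝓝 0)) {M : ℝ} (hM : ∀ k, D.reg (Z (k + 1)) ≤ M) :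
    ∃ x, IsSeqLimitPoint (fun k => (W k, F k, Z k, Y k)) x := by
  obtain ⟨R, hR⟩ := D.exists_abs_le_of_reg_le M
  have hcomp := (isCompact_setOf_abs_le (b := c) (fun _ : Fin m => d) R).prod
    (isCompact_setOf_abs_le (b := c) n (√c))
  obtain ⟨⟨Z', F'⟩, -, φ, hφ, hlim⟩ := hcomp.tendsto_subseq
    (x := fun k => (Z (k + 1), F (k + 1))) fun k => ⟨hR _ (hM k), fun t i j => by
      refine Real.abs_le_sqrt ?_
      rw [← frobSq_of_orthonormal (h.orthonormal hJ k t)]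
      exact sq_le_frobSq _ i j⟩
  have hZ : Tendsto (fun i => Z (φ i + 1)) atTop (𝓝 Z') := (continuous_fst.tendsto _).comp hlim
  have hF : Tendsto (fun i => F (φ i + 1)) atTop (𝓝 F') := (continuous_snd.tendsto _).comp hlim
  obtain ⟨hW, hY⟩ := h.tendsto_of_tendsto he hv hS hφ.tendsto_atTop hZ hF
  exact ⟨_, fun i => φ i + 1, hφ.add_const 1, hW.prodMk_nhds (hF.prodMk_nhds (hZ.prodMk_nhds hY))⟩

theorem IsRun.isKKT_of_limitPoint (h : D.IsRun ρ J η W F G Z Y) (hJ : 1 ≤ J) (hρ : 0 < ρ)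
    (hη : ∀ t, 0 < η t)
    (he : Tendsto (modelGap W Z) atTop (𝓝 0)) (hv : Tendsto (consensusStep Z) atTop (𝓝 0))
    (hS : Tendsto (embeddingStep J G) atTop (𝓝 0)) {W' Z' Y' : ModelStack m d c}
    {F' : EmbeddingStack n c}
    (hlim : IsSeqLimitPoint (fun k => (W k, F k, Z k, Y k)) (W', F', Z', Y')) :
    D.IsKKT W' F' Z' Y' := by
  obtain ⟨φ, hφ, hlim⟩ := hlim
  -- Dropping the first index makes every remaining iterate the output of a round.
  obtain ⟨ψ, hψ⟩ : ∃ ψ : ℕ → ℕ, ∀ i, ψ i + 1 = φ (i + 1) :=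
    ⟨fun i => φ (i + 1) - 1, fun i => Nat.sub_add_cancel
      ((Nat.succ_le_succ (Nat.zero_le i)).trans (hφ.id_le (i + 1)))⟩
  have hψ' : Tendsto ψ atTop atTop := tendsto_atTop_mono (fun i => by
    have := hφ.id_le (i + 1)
    have := hψ i
    simp only [id] at *
    omega) tendsto_id
  have hlim' := hlim.comp (tendsto_add_atTop_nat 1)
  have hsub : ∀ {α : Type} [TopologicalSpace α] {f : ℕ → α} {x : α},
      Tendsto (fun i => f (φ (i + 1))) atTop (𝓝 x) → Tendsto (fun i => f (ψ i + 1)) atTop (𝓝 x) :=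
    fun hf => hf.congr fun i => by rw [hψ]
  have hW : Tendsto (fun i => W (ψ i + 1)) atTop (𝓝 W') :=
    hsub ((continuous_fst.tendsto _).comp hlim')
  have hF : Tendsto (fun i => F (ψ i + 1)) atTop (𝓝 F') :=
    hsub ((continuous_snd.fst.tendsto _).comp hlim')
  have hZ : Tendsto (fun i => Z (ψ i + 1)) atTop (𝓝 Z') :=
    hsub ((continuous_snd.snd.fst.tendsto _).comp hlim')
  have hY : Tendsto (fun i => Y (ψ i + 1)) atTop (𝓝 Y') :=
    hsub ((continuous_snd.snd.snd.tendsto _).comp hlim')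
  obtain ⟨hWZ, hYg⟩ := h.tendsto_of_tendsto he hv hS hψ' hZ hF
  have hcons : W' = Z' := tendsto_nhds_unique hW hWZ
  have hY' := tendsto_nhds_unique hY hYg
  obtain ⟨j, rfl⟩ := Nat.exists_eq_add_of_le' hJ
  -- The last inner step of each round suffices: both its endpoints converge to `F' t`, and the
  -- projection relation is closed.
  have hproj : ∀ t, IsStiefelProj (F' t - η t • D.gradF t (W' t) (F' t)) (F' t) := by
    intro t
    have hFt := tendsto_pi_nhds.1 hF t
    have hG : Tendsto (fun i => G (ψ i) t j) atTop (𝓝 (F' t)) := by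
      have h1 := hFt.sub ((tendsto_embedding_step hS t (Nat.lt_succ_self j)).comp hψ')
      rw [sub_zero] at h1
      refine h1.congr fun i => ?_
      simp only [Function.comp_apply]
      rw [h.F_end]
      abel
    refine IsStiefelProj.of_tendsto (fun i => h.F_step (ψ i) t j (Nat.lt_succ_self j)) ?_
      (hFt.congr fun i => h.F_end _ _)
    exact hG.sub ((((D.continuous_gradF t).tendsto (W' t, F' t)).comp
      ((tendsto_pi_nhds.1 hW t).prodMk_nhds hG)).const_smul (η t))
  exact
    { consensus := hcons
      orthonormal := fun t => (hproj t).1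
      stationary_W := fun t => by rw [hY', hcons, add_neg_cancel]
      stationary_F := fun t => (hproj t).exists_multiplier (hη t).ne'
      stationary_Z := ⟨fun i => Z (ψ i + 1), fun i => Y (ψ i + 1),
        fun i => h.regularSubgradient hρ (ψ i), hZ, (D.continuous_reg.tendsto _).comp hZ, hY⟩ }

end FedProblem

theorem mainTheorem1 {m d c : ℕ} {n : Fin m → ℕ} (D : FedProblem m d c n)
    (J : ℕ) (hJ : 1 ≤ J) (cF : ℝ) (hcF : 0 < cF) :
    ∃ ρ₁ : ℝ, 0 < ρ₁ ∧ ∀ ρ : ℝ, ρ₁ ≤ ρ →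
      ∀ (η : Fin m → ℝ), (∀ t, 0 < η t) →
      ∀ (W : ℕ → ModelStack m d c) (F : ℕ → EmbeddingStack n c)
        (G : ℕ → (t : Fin m) → ℕ → Matrix (Fin (n t)) (Fin c) ℝ)
        (Z Y : ℕ → ModelStack m d c),
        D.IsRun ρ J η W F G Z Y →
        D.SufficientDecrease cF ρ J W F G Z Y →
        (∃ x, IsSeqLimitPoint (fun k => (W k, F k, Z k, Y k)) x) ∧
        ∀ (W' : ModelStack m d c) (F' : EmbeddingStack n c) (Z' Y' : ModelStack m d c),
          IsSeqLimitPoint (fun k => (W k, F k, Z k, Y k)) (W', F', Z', Y') →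
          D.IsKKT W' F' Z' Y' := by
  obtain ⟨ρ₁, hρ₁, H⟩ := D.exists_asymptotic_regularity hJ hcF
  refine ⟨ρ₁, hρ₁, fun ρ hρ η hη W F G Z Y h hS => ?_⟩
  obtain ⟨he, hv, hS', M, hM⟩ := H ρ hρ η W F G Z Y h hS
  exact ⟨h.exists_limitPoint hJ he hv hS' hM, fun W' F' Z' Y' hlim =>
    h.isKKT_of_limitPoint hJ (hρ₁.trans_le hρ) hη he hv hS' hlim⟩
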